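/- Let $\mathfrak{g}$ be a finite-dimensional semisimple Lie algebra over a field $\Bbbk$ of characteristic zero, let $\mathfrak{h}\subset\mathfrak{g}$ be a splitting Cartan subalgebra, let $\Delta\subset\mathfrak{h}^*\setminus\{0\}$ be the root system, with root space decomposition $\mathfrak{g}=\mathfrak{h}\oplus\bigoplus_{\alpha\in\Delta}\mathfrak{g}^\alpha$, let $\Delta_+\subset\Delta$ be the set of positive roots with respect to a base of $\Delta$, and put $\mathfrak{g}_+=\bigoplus_{\alpha\in\Delta_+}\mathfrak{g}^\alpha$. Fix a positive integer $N$ and let $$\hat{\mathfrak{g}}=\mathfrak{g}\otimes_{\Bbbk}\Bbbk[t]/t^{N+1}\Bbbk[t],\qquad [x\otimes t^i,y\otimes t^j]=[x,y]\otimes t^{i+j},$$ be the truncated current Lie algebra of nilpotency index $N$, with the subalgebras $\hat{\mathfrak{h}}=\mathfrak{h}\otimes\Bbbk[t]/t^{N+1}\Bbbk[t]$ and $\hat{\mathfrak{g}}_+=\mathfrak{g}_+\otimes\Bbbk[t]/t^{N+1}\Bbbk[t]$. For $\Lambda\in\hat{\mathfrak{h}}^*$ let $$M(\Lambda)=U(\hat{\mathfrak{g}})\otimes_{U(\hat{\mathfrak{h}}\oplus\hat{\mathfrak{g}}_+)}\Bbbk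 v_\Lambda,\qquad \hat{\mathfrak{g}}_+\cdot v_\Lambda=0,\quad h\cdot v_\Lambda=\Lambda(h)v_\Lambda\ \ (h\in\hat{\mathfrak{h}}),$$ be the Verma module of highest weight $\Lambda$ for $\hat{\mathfrak{g}}$, and let $\Lambda_N\in\mathfrak{h}^*$ be given by $\Lambda_N(h)=\Lambda(h\otimes t^N)$ for $h\in\mathfrak{h}$. Then, for every $\Lambda\in\hat{\mathfrak{h}}^*$, the module $M(\Lambda)$ is reducible (that is, it has a submodule other than $0$ and $M(\Lambda)$) if and only if there is a root $\alpha\in\Delta$ such that $\Lambda_N$ is orthogonal to $\alpha$ with respect to the symmetric bilinear form on $\mathfrak{h}^*$ transported from the restriction to $\mathfrak{h}$ of the Killing form of $\mathfrak{g}$. -/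

import Mathlib

open scoped TensorProduct

noncomputable section

namespace TruncatedCurrent

/-! ### Reducibility and induced modules -/

/-- A module is reducible if it has a submodule that is neither zero nor the whole module. -/
def IsReducible (R M : Type*) [Ring R] [AddCommGroup M] [Module R M] : Prop :=
  ∃ N : Submodule R M, N ≠ ⊥ ∧ N ≠ ⊤

section Induced

variable {K S R V : Type*} [Field K] [Ring S] [Algebra K S] [Ring R] [Algebra K R]
  [AddCommGroup V] [Module K V]

/-- The relations `(r s) ⊗ v = r ⊗ (s v)` that cut the tensor product over `S` out of the tensor
product over `K`.  Here `φ : S → R` makes `R` a right `S`-module and `ρ : S → End V` makes `V` a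
left `S`-module. -/
def balancedRelations (φ : S →ₐ[K] R) (ρ : S →ₐ[K] Module.End K V) :
    Submodule R (R ⊗[K] V) :=
  Submodule.span R
    {z | ∃ (r : R) (s : S) (v : V), z = (r * φ s) ⊗ₜ[K] v - r ⊗ₜ[K] (ρ s v)}

/-- The induced left `R`-module `R ⊗_S V`. -/
abbrev InducedModule (φ : S →ₐ[K] R) (ρ : S →ₐ[K] Module.End K V) : Type _ :=
  (R ⊗[K] V) ⧸ balancedRelations φ ρ

end Induced

/-! ### The truncated current Lie algebra -/

section Current

variable (K L : Type*) [Field K] [LieRing L] [LieAlgebra K L] (N : ℕ)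

/-- The truncated polynomial algebra `K[t] / t ^ (N + 1) K[t]`. -/
abbrev TruncPoly : Type _ :=
  AdjoinRoot ((Polynomial.X : Polynomial K) ^ (N + 1))

/-- The class of `t ^ d` in `K[t] / t ^ (N + 1) K[t]`. -/
def tPow (d : ℕ) : TruncPoly K N :=
  AdjoinRoot.mk _ (Polynomial.X ^ d)

/-- The truncated current Lie algebra of `L`, of nilpotency index `N`; the bracket is
`⁅a ⊗ x, b ⊗ y⁆ = (a * b) ⊗ ⁅x, y⁆`. -/
abbrev CurrentAlgebra : Type _ := TruncPoly K N ⊗[K] L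

variable {K L}

/-- The subspace `K[t] / t ^ (N + 1) K[t] ⊗ V` of the truncated current Lie algebra. -/
def currentSubspace (V : Submodule K L) : Submodule K (CurrentAlgebra K L N) :=
  LinearMap.range (V.subtype.lTensor (TruncPoly K N))

/-- The canonical surjection onto `currentSubspace N V` from the abstract tensor product with `V`. -/
def toCurrentSubspace (V : Submodule K L) : TruncPoly K N ⊗[K] V →ₗ[K] currentSubspace N V :=
  (V.subtype.lTensor (TruncPoly K N)).rangeRestrict

lemma coe_toCurrentSubspace_tmul (V : Submodule K L) (a : TruncPoly K N) (x : V) :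
    (toCurrentSubspace N V (a ⊗ₜ[K] x) : CurrentAlgebra K L N) = a ⊗ₜ[K] (x : L) :=
  rfl

lemma tmul_mem_currentSubspace {V : Submodule K L} (a : TruncPoly K N) {x : L} (hx : x ∈ V) :
    a ⊗ₜ[K] x ∈ currentSubspace N V :=
  ⟨a ⊗ₜ ⟨x, hx⟩, by simp⟩

lemma currentSubspace_induction {V : Submodule K L} {P : CurrentAlgebra K L N → Prop}
    (tmul : ∀ a, ∀ x ∈ V, P (a ⊗ₜ[K] x)) (zero : P 0) (add : ∀ x y, P x → P y → P (x + y))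
    {z : CurrentAlgebra K L N} (hz : z ∈ currentSubspace N V) : P z := by
  obtain ⟨w, rfl⟩ := hz
  induction w using TensorProduct.induction_on with
  | zero => simpa using zero
  | tmul a x => simpa using tmul a x x.2
  | add x y hx hy => rw [map_add]; exact add _ _ hx hy

lemma lie_mem_currentSubspace {V W X : Submodule K L}
    (h : ∀ x ∈ V, ∀ y ∈ W, ⁅x, y⁆ ∈ X) {x y : CurrentAlgebra K L N}
    (hx : x ∈ currentSubspace N V) (hy : y ∈ currentSubspace N W) :
    ⁅x, y⁆ ∈ currentSubspace N X := by
  refine currentSubspace_induction N (P := fun x => ⁅x, y⁆ ∈ currentSubspace N X) ?_ ?_ ?_ hx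
  · intro a x hx
    refine currentSubspace_induction N
      (P := fun y => ⁅a ⊗ₜ[K] x, y⁆ ∈ currentSubspace N X) ?_ ?_ ?_ hy
    · intro c y hy
      rw [LieAlgebra.ExtendScalars.bracket_tmul]
      exact tmul_mem_currentSubspace N _ (h x hx y hy)
    · simp
    · intro u v hu hv
      rw [lie_add]
      exact add_mem hu hv
  · simp
  · intro u v hu hv
    rw [add_lie]
    exact add_mem hu hv

end Current

/-! ### The triangular decomposition -/

section Triangular

open LieAlgebra LieModule LieAlgebra.IsKilling

variable {K L : Type*} [Field K] [CharZero K] [LieRing L] [LieAlgebra K L]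
  [FiniteDimensional K L] [IsKilling K L]
  {H : LieSubalgebra K L} [H.IsCartanSubalgebra] [IsTriangularizable K H L]

/-- The sum of the root spaces of the positive roots with respect to a base. -/
def positivePart (b : (rootSystem H).Base) : Submodule K L :=
  ⨆ α : {α : H.root // b.IsPos α}, (rootSpace H (α.1.1 : H → K)).toSubmodule

variable (H) in
/-- The sum of all the root spaces. -/
def rootPart : Submodule K L :=
  ⨆ α : H.root, (rootSpace H (α.1 : H → K)).toSubmodule

lemma positivePart_le_rootPart (b : (rootSystem H).Base) : positivePart b ≤ rootPart H :=
  iSup_le fun α => le_iSup (fun α : H.root => (rootSpace H (α.1 : H → K)).toSubmodule) α.1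

variable (H) in
lemma isCompl_cartan_rootPart : IsCompl H.toSubmodule (rootPart H) := by
  have h0 : H.toSubmodule = (rootSpace H (0 : H → K)).toSubmodule := by
    rw [rootSpace_zero_eq]; rfl
  have hind := LieModule.iSupIndep_genWeightSpace K H L
  rw [← LieSubmodule.iSupIndep_toSubmodule] at hind
  constructor
  · rw [h0]
    refine (hind 0).mono_right (iSup_le fun α => ?_)
    have hα : (α.1 : H → K) ≠ 0 := by
      have := α.2
      exact (Finset.mem_filter.mp this).2
    exact le_iSup₂_of_le (α.1 : H → K) hα le_rfl
  · rw [codisjoint_iff, eq_top_iff, ← LieSubmodule.top_toSubmodule (R := K) (L := H) (M := L),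
      ← LieModule.iSup_genWeightSpace_eq_top' K H L, LieSubmodule.iSup_toSubmodule]
    refine iSup_le fun χ => ?_
    by_cases hχ : χ.IsZero
    · refine le_trans (le_of_eq ?_) le_sup_left
      have hχ' : (χ : H → K) = 0 := hχ
      rw [h0, hχ']
    · have hm : χ ∈ H.root := by simpa [LieSubalgebra.root] using hχ
      exact le_trans
        (le_iSup (fun α : H.root => (rootSpace H (α.1 : H → K)).toSubmodule) ⟨χ, hm⟩) le_sup_right

lemma lie_mem_positivePart_of_cartan (b : (rootSystem H).Base) {h x : L}
    (hh : h ∈ H.toSubmodule) (hx : x ∈ positivePart b) : ⁅h, x⁆ ∈ positivePart b := by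
  induction hx using Submodule.iSup_induction' with
  | mem α x hx =>
    exact Submodule.mem_iSup_of_mem α
      ((rootSpace H (α.1.1 : H → K)).lie_mem (x := (⟨h, hh⟩ : H)) hx)
  | zero => simp
  | add x y _ _ hx hy => rw [lie_add]; exact add_mem hx hy

lemma lie_mem_positivePart (b : (rootSystem H).Base) {x y : L}
    (hx : x ∈ positivePart b) (hy : y ∈ positivePart b) : ⁅x, y⁆ ∈ positivePart b := by
  induction hx using Submodule.iSup_induction' with
  | mem α x hx =>
    induction hy using Submodule.iSup_induction' with
    | mem β y hy =>
      have hxy : ⁅x, y⁆ ∈ rootSpace H ((α.1.1 : H → K) + β.1.1) :=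
        lie_mem_genWeightSpace_of_mem_genWeightSpace hx hy
      by_cases hbot : rootSpace H ((α.1.1 : H → K) + β.1.1) = ⊥
      · rw [hbot, LieSubmodule.mem_bot] at hxy
        rw [hxy]; exact zero_mem _
      · let γ : Weight K H L := ⟨(α.1.1 : H → K) + β.1.1, hbot⟩
        have hγ : γ.IsNonZero := by
          intro h0
          have h0' : (α.1.1 : H → K) + β.1.1 = 0 := h0
          let := (rootSystem H).indexNeg
          have hneg : α.1 = -β.1 := by
            apply (rootSystem H).root.injective
            rw [RootPairing.indexNeg_neg, RootPairing.root_reflectionPerm,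
              RootPairing.reflection_apply_self]
            ext z
            have := congrFun h0' z
            simp only [Pi.add_apply, Pi.zero_apply] at this
            simpa using eq_neg_of_add_eq_zero_left this
          have := α.2
          rw [hneg, RootPairing.Base.IsPos.neg_iff_not] at this
          exact this β.2
        have hm : γ ∈ H.root := by simpa [LieSubalgebra.root] using hγ
        have hpos : b.IsPos ⟨γ, hm⟩ := by
          refine RootPairing.Base.IsPos.add α.2 β.2 ?_
          ext z
          simp [γ]
        exact Submodule.mem_iSup_of_mem
          (p := fun α : {α : H.root // b.IsPos α} => (rootSpace H (α.1.1 : H → K)).toSubmodule)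
          ⟨⟨γ, hm⟩, hpos⟩ hxy
    | zero => simp
    | add y z _ _ hy hz => rw [lie_add]; exact add_mem hy hz
  | zero => simp
  | add x z _ _ hx hz => rw [add_lie]; exact add_mem hx hz

variable (H) in
/-- The diagonal subalgebra `ĥ = h ⊗ K[t] / t ^ (N + 1) K[t]`. -/
abbrev cartanHat (N : ℕ) : Submodule K (CurrentAlgebra K L N) := currentSubspace N H.toSubmodule

/-- The positive part `ĝ₊ = g₊ ⊗ K[t] / t ^ (N + 1) K[t]`. -/
abbrev positiveHat (b : (rootSystem H).Base) (N : ℕ) : Submodule K (CurrentAlgebra K L N) :=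
  currentSubspace N (positivePart b)

/-- Brackets of elements of `ĥ ⊕ ĝ₊` lie in `ĝ₊`. -/
lemma lie_mem_positiveHat (b : (rootSystem H).Base) (N : ℕ) {x y : CurrentAlgebra K L N}
    (hx : x ∈ cartanHat H N ⊔ positiveHat b N) (hy : y ∈ cartanHat H N ⊔ positiveHat b N) :
    ⁅x, y⁆ ∈ positiveHat b N := by
  obtain ⟨h₁, hh₁, e₁, he₁, rfl⟩ := Submodule.mem_sup.mp hx
  obtain ⟨h₂, hh₂, e₂, he₂, rfl⟩ := Submodule.mem_sup.mp hy
  have h11 : ⁅h₁, h₂⁆ ∈ positiveHat b N := by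
    refine lie_mem_currentSubspace N (fun x hx y hy => ?_) hh₁ hh₂
    have : ⁅(⟨x, hx⟩ : H), (⟨y, hy⟩ : H)⁆ = 0 := trivial_lie_zero _ _ _ _
    have h' : ⁅x, y⁆ = 0 := congrArg Subtype.val this
    rw [h']; exact zero_mem _
  have h12 : ⁅h₁, e₂⁆ ∈ positiveHat b N :=
    lie_mem_currentSubspace N (fun x hx y hy => lie_mem_positivePart_of_cartan b hx hy) hh₁ he₂
  have h21 : ⁅e₁, h₂⁆ ∈ positiveHat b N :=
    lie_mem_currentSubspace N (fun x hx y hy => by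
      rw [← lie_skew]
      exact neg_mem (lie_mem_positivePart_of_cartan b hy hx)) he₁ hh₂
  have h22 : ⁅e₁, e₂⁆ ∈ positiveHat b N :=
    lie_mem_currentSubspace N (fun x hx y hy => lie_mem_positivePart b hx hy) he₁ he₂
  rw [add_lie, lie_add, lie_add]
  exact add_mem (add_mem h11 h12) (add_mem h21 h22)

/-- The subalgebra `ĥ ⊕ ĝ₊` of the truncated current Lie algebra. -/
def borelHat (b : (rootSystem H).Base) (N : ℕ) : LieSubalgebra K (CurrentAlgebra K L N) where
  toSubmodule := cartanHat H N ⊔ positiveHat b N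
  lie_mem' hx hy := (le_sup_right : positiveHat b N ≤ _) (lie_mem_positiveHat b N hx hy)

variable (H) in
/-- The projection of the truncated current Lie algebra onto `ĥ` along all the root spaces. -/
def cartanHatProj (N : ℕ) : CurrentAlgebra K L N →ₗ[K] cartanHat H N :=
  toCurrentSubspace N H.toSubmodule ∘ₗ
    (Submodule.projectionOnto _ _ (isCompl_cartan_rootPart H)).lTensor (TruncPoly K N)

variable (H) in
lemma cartanHatProj_apply_of_mem (N : ℕ) (x : cartanHat H N) :
    cartanHatProj H N (x : CurrentAlgebra K L N) = x := by
  apply Subtype.ext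
  refine currentSubspace_induction N
    (P := fun x => (cartanHatProj H N x : CurrentAlgebra K L N) = x) ?_ ?_ ?_ x.2
  · intro a x hx
    have := Submodule.projectionOnto_apply_left (isCompl_cartan_rootPart H) ⟨x, hx⟩
    change a ⊗ₜ[K] ((Submodule.projectionOnto _ _ (isCompl_cartan_rootPart H) x : H.toSubmodule) : L)
      = a ⊗ₜ[K] x
    rw [this]
  · simp
  · intro u v hu hv
    rw [map_add, Submodule.coe_add, hu, hv]

lemma cartanHatProj_apply_of_mem_positiveHat (b : (rootSystem H).Base) (N : ℕ)
    {x : CurrentAlgebra K L N} (hx : x ∈ positiveHat b N) : cartanHatProj H N x = 0 := by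
  refine currentSubspace_induction N (P := fun x => cartanHatProj H N x = 0) ?_ ?_ ?_ hx
  · intro a x hx
    have := (Submodule.projectionOnto_apply_eq_zero_iff (isCompl_cartan_rootPart H)).mpr
      (positivePart_le_rootPart b hx)
    simp only [cartanHatProj, LinearMap.comp_apply, LinearMap.lTensor_tmul]
    rw [this, TensorProduct.tmul_zero, map_zero]
  · simp
  · intro u v hu hv
    rw [map_add, hu, hv, add_zero]

attribute [local instance 100] LieRing.ofAssociativeRing

/-- The one-dimensional representation of `ĥ ⊕ ĝ₊` on which `ĥ` acts through `Λ` and `ĝ₊` acts by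
zero, as a character. -/
def borelCharacter (b : (rootSystem H).Base) (N : ℕ) (Λ : Module.Dual K (cartanHat H N)) :
    LieCharacter K (borelHat b N) where
  toLinearMap := Λ ∘ₗ cartanHatProj H N ∘ₗ (borelHat b N).toSubmodule.subtype
  map_lie' {x y} := by
    have h : cartanHatProj H N ⁅(x : CurrentAlgebra K L N), (y : CurrentAlgebra K L N)⁆ = 0 :=
      cartanHatProj_apply_of_mem_positiveHat b N (lie_mem_positiveHat b N x.2 y.2)
    have h' : ⁅(Λ ∘ₗ cartanHatProj H N ∘ₗ (borelHat b N).toSubmodule.subtype) x,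
        (Λ ∘ₗ cartanHatProj H N ∘ₗ (borelHat b N).toSubmodule.subtype) y⁆ = 0 := by
      rw [LieRing.of_associative_ring_bracket, mul_comm, sub_self]
    refine Eq.trans ?_ h'.symm
    exact (congrArg Λ h).trans (map_zero Λ)

lemma borelCharacter_cartanHat (b : (rootSystem H).Base) (N : ℕ)
    (Λ : Module.Dual K (cartanHat H N)) (x : cartanHat H N) :
    borelCharacter b N Λ ⟨x, (le_sup_left : cartanHat H N ≤ _) x.2⟩ = Λ x :=
  congrArg Λ (cartanHatProj_apply_of_mem H N x)

lemma borelCharacter_positiveHat (b : (rootSystem H).Base) (N : ℕ)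
    (Λ : Module.Dual K (cartanHat H N)) (x : positiveHat b N) :
    borelCharacter b N Λ ⟨x, (le_sup_right : positiveHat b N ≤ _) x.2⟩ = 0 :=
  (congrArg Λ (cartanHatProj_apply_of_mem_positiveHat b N x.2)).trans (map_zero Λ)

/-- The homomorphism `U(ĥ ⊕ ĝ₊) → U(ĝ)` of enveloping algebras given by the inclusion. -/
def borelInclusion (b : (rootSystem H).Base) (N : ℕ) :
    UniversalEnvelopingAlgebra K (borelHat b N) →ₐ[K]
      UniversalEnvelopingAlgebra K (CurrentAlgebra K L N) :=
  UniversalEnvelopingAlgebra.lift K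
    ((UniversalEnvelopingAlgebra.ι K).comp (borelHat b N).incl)

/-- The action of `U(ĥ ⊕ ĝ₊)` on the one-dimensional space `K v_Λ`, identified with `K`. -/
def borelAction (b : (rootSystem H).Base) (N : ℕ) (Λ : Module.Dual K (cartanHat H N)) :
    UniversalEnvelopingAlgebra K (borelHat b N) →ₐ[K] Module.End K K :=
  (Algebra.lmul K K).comp (UniversalEnvelopingAlgebra.lift K (borelCharacter b N Λ))

/-- The Verma module `M(Λ) = U(ĝ) ⊗_{U(ĥ ⊕ ĝ₊)} K v_Λ` of the truncated current Lie algebra. -/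
abbrev Verma (b : (rootSystem H).Base) (N : ℕ) (Λ : Module.Dual K (cartanHat H N)) : Type _ :=
  InducedModule (borelInclusion b N) (borelAction b N Λ)

/-- The functional `Λ_d` on the Cartan subalgebra `h`, with `Λ_d(x) = Λ(x ⊗ t ^ d)`. -/
def component {N : ℕ} (Λ : Module.Dual K (cartanHat H N)) (d : ℕ) : Module.Dual K H :=
  Λ ∘ₗ toCurrentSubspace N H.toSubmodule ∘ₗ
    TensorProduct.mk K (TruncPoly K N) H.toSubmodule (tPow K N d)

lemma component_apply {N : ℕ} (Λ : Module.Dual K (cartanHat H N)) (d : ℕ) (x : H) :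
    component Λ d x = Λ ⟨tPow K N d ⊗ₜ (x : L), tmul_mem_currentSubspace N _ x.2⟩ :=
  rfl

variable (H) in
/-- The bilinear form on `h*` transported from the Killing form on `h`: it sends `(λ, μ)` to
`κ(h_λ, h_μ)`, where `h_λ` in `h` is such that `κ(h_λ, x) = λ(x)` for all `x` in `h`. -/
def dualKillingForm : LinearMap.BilinForm K (Module.Dual K H) :=
  (killingForm K L).compl₁₂
    (H.toSubmodule.subtype ∘ₗ (cartanEquivDual H).symm.toLinearMap)
    (H.toSubmodule.subtype ∘ₗ (cartanEquivDual H).symm.toLinearMap)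

variable (H) in
lemma dualKillingForm_apply (l m : Module.Dual K H) :
    dualKillingForm H l m = l ((cartanEquivDual H).symm m) := by
  conv_rhs => rw [← (cartanEquivDual H).apply_symm_apply l]
  rfl

end Triangular

end TruncatedCurrent

end

/-!
# Reducibility of Verma modules of truncated current Lie algebras

Let `e a`, `f a` be opposite root vectors for the positive roots `a`. The value of `Λ_N` at
`⁅e a, f a⁆` is its inner product with `a`. Both directions study the Verma module through the
operators by which the elements `t ^ i ⊗ e a` and `t ^ i ⊗ f a` act, and of the structure of the
root system only the heights of the roots are used (`TriangularVectors`, `HighestWeightRep`).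

Suppose that `Λ_N` is orthogonal to no root. Words in the lowering operators applied to the
highest weight vector span the module. If `t ^ i ⊗ f a` is given a suitable weight
`g (ht a) - s * i`, the lowering operators commute up to terms of lower weight, and `t ^ j ⊗ e b`
acts to leading order as `Λ_N ⁅e b, f b⁆` times the formal derivative with respect to
`t ^ (N - j) ⊗ f b` (`ρ_e_word`); such weights exist because the truncation at `t ^ N` leaves room
for them (`exists_isAdapted`). As all these constants are nonzero, the Euler operator of the
filtration is, to leading order, a combination of raising operators followed by lowering operators
(`euler_word`). A vector of positive weight is therefore sent by some raising operator to a
nonzero vector of lower weight (`mem_filt_sub_one`), while the vectors of weight zero are the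
multiples of the highest weight vector. By induction on the weight, every nonzero submodule
contains the highest weight vector (`v_mem_of_regular`). The argument needs only that words span;
that they are independent plays no role in it.

Suppose that `Λ_N` is orthogonal to a root, without loss of generality to a positive root `a`. Let
`φ` be the functional that takes the coefficient of the highest weight vector. The vectors killed
by `φ` after every sequence of raising operators form a proper submodule, the radical of the
Shapovalov form (`ρ_mem_radical`). It is nonzero: pair the words in the `t ^ N ⊗ f b` of total
height `ht a` with the words in the `1 ⊗ e b` of the same height. This pairing is a square matrix,
and its row for the single letter `e a` is zero, as `⁅e a, f a⁆` has value zero. So some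
nontrivial combination of the words in the `t ^ N ⊗ f b` is in the radical
(`exists_stable_of_singular`).

The second part needs the words to be linearly independent, which is an instance of the
Poincaré-Birkhoff-Witt theorem. For a Lie algebra with trivial centre over a field of
characteristic zero it has a direct proof: the adjoint representation is faithful, so the Lie
algebra acts by vector fields on the coordinate ring of the space of matrices, and these are
linearly independent at the identity matrix. A linear combination of words is thus detected by
applying it to monomials that vanish at the identity to the order of the length of a longest word
(`DualAction.linearIndependent_words`, `envelopingDualAction`). Constants may be subtracted from
the generators without harm, and this carries independence over to modules induced from characters
(`SplitBasis.linearIndependent_mk_yWord`).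
-/

open scoped TensorProduct

noncomputable section

namespace TruncatedCurrent

/-! ### Root vectors sorted by height -/

/-- Root vectors `e a`, `f a` for opposite roots indexed by `a`, with a height `ht a`, and a
diagonal subspace `H` that normalizes the lines spanned by the `f a`.  Of the bracket relations of
a split semisimple Lie algebra only what the heights say about them is recorded. -/
structure TriangularVectors (K L Φ : Type*) [Field K] [LieRing L] [LieAlgebra K L] where
  /-- The diagonal part. -/
  H : Submodule K L
  /-- The height of a positive root. -/
  ht : Φ → ℕ
  /-- The positive root vectors. -/
  e : Φ → L
  /-- The negative root vectors. -/
  f : Φ → L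
  ht_pos (a : Φ) : 0 < ht a
  lie_cartan_f (h : L) (hh : h ∈ H) (a : Φ) : ∃ c : K, ⁅h, f a⁆ = c • f a
  lie_e_e (a b : Φ) : ⁅e a, e b⁆ ∈ Submodule.span K (e '' {c | ht c = ht a + ht b})
  lie_f_f (a b : Φ) : ⁅f a, f b⁆ ∈ Submodule.span K (f '' {c | ht c = ht a + ht b})
  lie_e_f_of_lt (a b : Φ) (h : ht a < ht b) :
    ⁅e a, f b⁆ ∈ Submodule.span K (f '' {c | ht c + ht a = ht b})
  lie_e_f_of_gt (a b : Φ) (h : ht b < ht a) :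
    ⁅e a, f b⁆ ∈ Submodule.span K (e '' {c | ht c + ht b = ht a})
  lie_e_f_of_eq (a b : Φ) (h : ht a = ht b) (hab : a ≠ b) : ⁅e a, f b⁆ = 0
  lie_e_f_self (a : Φ) : ⁅e a, f a⁆ ∈ H
  span_eq_top : Submodule.span K (Set.range f) ⊔ H ⊔ Submodule.span K (Set.range e) = ⊤

/-- A representation of the truncated current Lie algebra, given by the operators `ρ i x` by which
the elements `t ^ i ⊗ x` act, together with a vector `v` killed by the positive part, on which the
diagonal part acts by scalars. -/
structure HighestWeightRep {K L Φ : Type*} [Field K] [LieRing L] [LieAlgebra K L]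
    (T : TriangularVectors K L Φ) (N : ℕ) (M : Type*) [AddCommGroup M] [Module K M] where
  /-- The action of `t ^ i ⊗ x`. -/
  ρ : ℕ → L →ₗ[K] Module.End K M
  /-- The highest weight vector. -/
  v : M
  /-- The components of the highest weight. -/
  wt : ℕ → L → K
  comm (i j : ℕ) (x y : L) (m : M) : ρ i x (ρ j y m) = ρ j y (ρ i x m) + ρ (i + j) ⁅x, y⁆ m
  trunc (i : ℕ) (hi : N < i) : ρ i = 0
  ρ_e_v (i : ℕ) (a : Φ) : ρ i (T.e a) v = 0
  ρ_cartan_v (i : ℕ) (h : L) (hh : h ∈ T.H) : ρ i h v = wt i h • v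
  cyclic (S : Submodule K M) (hv : v ∈ S) (hS : ∀ i x, ∀ m ∈ S, ρ i x m ∈ S) : S = ⊤

namespace HighestWeightRep

variable {K L Φ : Type*} [Field K] [LieRing L] [LieAlgebra K L]
  {T : TriangularVectors K L Φ} {N : ℕ} {M : Type*} [AddCommGroup M] [Module K M]
  (R : HighestWeightRep T N M)

/-- The operator by which `t ^ i ⊗ f a` acts. -/
def Y (p : Φ × Fin (N + 1)) : Module.End K M := R.ρ p.2 (T.f p.1)

/-- The result of applying a list of lowering operators to the highest weight vector. -/
def word : List (Φ × Fin (N + 1)) → M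
  | [] => R.v
  | p :: l => R.Y p (word l)

@[simp] lemma word_nil : R.word [] = R.v := rfl

@[simp] lemma word_cons (p : Φ × Fin (N + 1)) (l : List (Φ × Fin (N + 1))) :
    R.word (p :: l) = R.Y p (R.word l) := rfl

/-! ### Regular highest weights: every nonzero submodule contains the highest weight vector -/

/-- A weight on the lowering operators: `t ^ i ⊗ f a` has weight `g (ht a) - s * i`. -/
def deg (g : ℕ → ℤ) (s : ℤ) (p : Φ × Fin (N + 1)) : ℤ := g (T.ht p.1) - s * (p.2 : ℕ)

/-- The span of the words of weight at most `D`. -/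
def filt (g : ℕ → ℤ) (s : ℤ) (D : ℤ) : Submodule K M :=
  Submodule.span K {m | ∃ l : List (Φ × Fin (N + 1)), (l.map (deg (T := T) g s)).sum ≤ D ∧
    m = R.word l}

/-- The conditions on a weight under which `t ^ j ⊗ e b` acts to leading order as a derivative with
respect to `t ^ (N - j) ⊗ f b`. -/
structure IsAdapted (T : TriangularVectors K L Φ) (N : ℕ) (g : ℕ → ℤ) (s : ℤ) : Prop where
  s_pos : 0 < s
  N_pos : 0 < N
  subadd (m n : ℕ) (hm : 0 < m) (hn : 0 < n) : g (m + n) + 1 ≤ g m + g n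
  superadd (m n : ℕ) (a : Φ) (h : m + n = T.ht a) : g m + g n + 1 ≤ g (m + n) + s * N
  lt_g (a : Φ) : s * N < g (T.ht a)

variable (g : ℕ → ℤ) (s : ℤ)

lemma word_mem_filt {l : List (Φ × Fin (N + 1))} {D : ℤ}
    (h : (l.map (deg (T := T) g s)).sum ≤ D) : R.word l ∈ R.filt g s D :=
  Submodule.subset_span ⟨l, h, rfl⟩

lemma filt_mono {D D' : ℤ} (h : D ≤ D') : R.filt g s D ≤ R.filt g s D' :=
  Submodule.span_mono fun _ ⟨l, hl, e⟩ => ⟨l, hl.trans h, e⟩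

/-- To map one step of the filtration into a subspace, a linear map has only to do so on words. -/
lemma map_mem_of_word {D : ℤ} {φ : Module.End K M} {S : Submodule K M}
    (h : ∀ l : List (Φ × Fin (N + 1)), (l.map (deg (T := T) g s)).sum ≤ D → φ (R.word l) ∈ S)
    {m : M} (hm : m ∈ R.filt g s D) : φ m ∈ S := by
  have : R.filt g s D ≤ S.comap φ := Submodule.span_le.mpr (by
    rintro _ ⟨l, hl, rfl⟩
    exact h l hl)
  exact this hm

lemma Y_mem_filt (p : Φ × Fin (N + 1)) {D : ℤ} {m : M} (hm : m ∈ R.filt g s D) :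
    R.Y p m ∈ R.filt g s (D + deg (T := T) g s p) := by
  refine R.map_mem_of_word g s (fun l hl => R.word_mem_filt g s (l := p :: l) ?_) hm
  simp only [List.map_cons, List.sum_cons]
  linarith

/-- A linear combination of negative root vectors of height `n`, times `t ^ i`. -/
lemma ρ_span_f_mem_filt {i n : ℕ} {x : L} {S : Set Φ} (hS : ∀ c ∈ S, T.ht c = n)
    (hx : x ∈ Submodule.span K (T.f '' S)) {D D' : ℤ}
    (hD : i ≤ N → 0 < n → D + (g n - s * i) ≤ D') {m : M} (hm : m ∈ R.filt g s D) :
    R.ρ i x m ∈ R.filt g s D' := by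
  by_cases hi : i ≤ N
  · induction hx using Submodule.span_induction with
    | mem x hx =>
      obtain ⟨c, hc, rfl⟩ := hx
      have hn : 0 < n := hS c hc ▸ T.ht_pos c
      refine R.filt_mono g s (hD hi hn)
        (R.filt_mono g s (le_of_eq ?_) (R.Y_mem_filt g s (c, ⟨i, by omega⟩) hm))
      simp [deg, hS c hc]
    | zero => simp
    | add x y _ _ hx hy => rw [map_add]; exact add_mem hx hy
    | smul c x _ hx => rw [map_smul]; exact Submodule.smul_mem _ _ hx
  · rw [R.trunc i (by omega)]; simp

variable {g s}

lemma Y_swap_mem_filt (hg : IsAdapted T N g s) (p q : Φ × Fin (N + 1)) {D : ℤ} {m : M}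
    (hm : m ∈ R.filt g s D) :
    R.Y p (R.Y q m) - R.Y q (R.Y p m) ∈
      R.filt g s (D + deg (T := T) g s p + deg (T := T) g s q - 1) := by
  rw [Y, Y, R.comm, add_sub_cancel_left]
  refine R.ρ_span_f_mem_filt g s (n := T.ht p.1 + T.ht q.1) (fun c hc => hc) (T.lie_f_f _ _)
    (fun _ _ => ?_) hm
  have := hg.subadd _ _ (T.ht_pos p.1) (T.ht_pos q.1)
  simp only [deg]
  push_cast
  linarith

/-- The diagonal operator `t ^ k ⊗ h` acts by its value on the highest weight vector, up to terms
of lower weight than `s * (N - k)`. -/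
lemma ρ_cartan_word (hg : IsAdapted T N g s) {h : L} (hh : h ∈ T.H) (k : ℕ)
    (l : List (Φ × Fin (N + 1))) :
    R.ρ k h (R.word l) - R.wt k h • R.word l ∈
      R.filt g s ((l.map (deg (T := T) g s)).sum + s * (N - k) - 1) := by
  induction l with
  | nil => simp [R.ρ_cartan_v k h hh]
  | cons p l ih =>
    obtain ⟨c, hc⟩ := T.lie_cartan_f h hh p.1
    have key : R.ρ k h (R.word (p :: l)) - R.wt k h • R.word (p :: l) =
        R.Y p (R.ρ k h (R.word l) - R.wt k h • R.word l) +
          R.ρ (k + p.2) (c • T.f p.1) (R.word l) := by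
      rw [word_cons, Y, R.comm, hc, map_sub, map_smul (R.ρ p.2 (T.f p.1))]
      abel
    rw [key]
    refine add_mem (R.filt_mono g s ?_ (R.Y_mem_filt g s p ih)) ?_
    · simp only [List.map_cons, List.sum_cons]; linarith
    · refine R.ρ_span_f_mem_filt g s (n := T.ht p.1) (S := {p.1}) (by simp)
        (Submodule.smul_mem _ _ (Submodule.subset_span (by simp))) (fun _ _ => ?_)
        (R.word_mem_filt g s le_rfl)
      have h1 : 1 ≤ s * N := by
        have := mul_pos hg.s_pos (by exact_mod_cast hg.N_pos : (0 : ℤ) < N)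
        linarith
      simp only [List.map_cons, List.sum_cons, deg]
      push_cast
      linarith

variable [DecidableEq Φ]

/-- The formal derivative of a word with respect to a lowering operator. -/
def pderiv (q : Φ × Fin (N + 1)) : List (Φ × Fin (N + 1)) → M
  | [] => 0
  | p :: l => (if p = q then R.word l else 0) + R.Y p (pderiv q l)

lemma pderiv_mem_filt (q : Φ × Fin (N + 1)) (l : List (Φ × Fin (N + 1))) :
    R.pderiv q l ∈ R.filt g s ((l.map (deg (T := T) g s)).sum - deg (T := T) g s q) := by
  induction l with
  | nil => exact zero_mem _
  | cons p l ih =>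
    refine add_mem ?_ (R.filt_mono g s ?_ (R.Y_mem_filt g s p ih))
    · split_ifs with h
      · subst h; exact R.word_mem_filt g s (by simp)
      · exact zero_mem _
    · simp only [List.map_cons, List.sum_cons]; linarith

/-- To leading order, `t ^ j ⊗ e b` acts on words as a multiple of the derivative with respect to
`t ^ (N - j) ⊗ f b`: the multiple is the value of the last component of the highest weight at
`⁅e b, f b⁆`. -/
lemma ρ_e_word (hg : IsAdapted T N g s) (l : List (Φ × Fin (N + 1))) :
    ∀ (b : Φ) (j : Fin (N + 1)),
      R.ρ j (T.e b) (R.word l) - R.wt N ⁅T.e b, T.f b⁆ • R.pderiv (b, j.rev) l ∈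
      R.filt g s ((l.map (deg (T := T) g s)).sum - deg (T := T) g s (b, j.rev) - 1) := by
  induction l with
  | nil => intro b j; simp [R.ρ_e_v, pderiv]
  | cons p l ih =>
    intro b j
    obtain ⟨a, i⟩ := p
    set Dl := (l.map (deg (T := T) g s)).sum with hDl
    have hrev (j : Fin (N + 1)) : ((j.rev : ℕ) : ℤ) = N - j := by
      have := j.2; rw [Fin.val_rev]; omega
    have key : R.ρ j (T.e b) (R.word ((a, i) :: l)) -
        R.wt N ⁅T.e b, T.f b⁆ • R.pderiv (b, j.rev) ((a, i) :: l) =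
        R.Y (a, i) (R.ρ j (T.e b) (R.word l) - R.wt N ⁅T.e b, T.f b⁆ • R.pderiv (b, j.rev) l) +
        (R.ρ (j + i) ⁅T.e b, T.f a⁆ (R.word l) - R.wt N ⁅T.e b, T.f b⁆ •
          (if (a, i) = (b, j.rev) then R.word l else 0)) := by
      rw [word_cons, Y, R.comm, pderiv, smul_add, map_sub, map_smul, Y]
      abel
    rw [key]
    refine add_mem (R.filt_mono g s ?_ (R.Y_mem_filt g s (a, i) (ih b j))) ?_
    · simp only [List.map_cons, List.sum_cons]; linarith
    simp only [List.map_cons, List.sum_cons, ← hDl]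
    rcases lt_trichotomy (T.ht a) (T.ht b) with hab | hab | hab
    · -- the bracket is a combination of positive root vectors of smaller height
      have hne : (a, i) ≠ (b, j.rev) := fun h => by
        rw [Prod.mk.injEq] at h; rw [h.1] at hab; exact lt_irrefl _ hab
      rw [if_neg hne, smul_zero, sub_zero]
      by_cases hN : N < j + i
      · rw [R.trunc _ hN]; simp
      have hmem := T.lie_e_f_of_gt b a hab
      generalize ⁅T.e b, T.f a⁆ = x at hmem
      induction hmem using Submodule.span_induction with
      | mem x hx =>
        obtain ⟨c, hc, rfl⟩ := hx
        have h1 := ih c ⟨j + i, by omega⟩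
        have h2 := R.pderiv_mem_filt (g := g) (s := s) (c, Fin.rev ⟨j + i, by omega⟩) l
        have h3 := add_mem (R.filt_mono g s (sub_le_self _ zero_le_one) h1)
          (Submodule.smul_mem _ (R.wt N ⁅T.e c, T.f c⁆) h2)
        rw [sub_add_cancel] at h3
        refine R.filt_mono g s ?_ h3
        have h4 := hg.subadd _ _ (T.ht_pos c) (T.ht_pos a)
        rw [show T.ht c + T.ht a = T.ht b from hc] at h4
        simp only [deg, hrev]
        push_cast
        linarith
      | zero => simp
      | add x y _ _ hx hy => rw [map_add]; exact add_mem hx hy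
      | smul c x _ hx => rw [map_smul]; exact Submodule.smul_mem _ _ hx
    · by_cases hab' : a = b
      · subst hab'
        by_cases hN : N < j + i
        · have hne : (a, i) ≠ (a, j.rev) := fun h => by
            rw [Prod.mk.injEq] at h
            have := congrArg Fin.val h.2
            rw [Fin.val_rev] at this; omega
          rw [R.trunc _ hN, if_neg hne]; simp
        · have h1 := R.ρ_cartan_word hg (T.lie_e_f_self a) (j + i) l
          rw [← hDl] at h1
          by_cases hi : i = j.rev
          · have hji : (j : ℕ) + i = N := by rw [hi, Fin.val_rev]; omega
            rw [hji] at h1 ⊢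
            rw [if_pos (by rw [hi])]
            refine R.filt_mono g s (le_of_eq ?_) h1
            rw [hi]; ring
          · have hji : (j : ℕ) + i < N := by
              refine lt_of_le_of_ne (by omega) fun h => hi (Fin.ext ?_)
              rw [Fin.val_rev]; omega
            rw [if_neg (by simpa using hi), smul_zero, sub_zero, ← sub_add_cancel (R.ρ _ _ _)
              (R.wt (j + i) ⁅T.e a, T.f a⁆ • R.word l)]
            have h2 : s * 1 ≤ s * ((N : ℤ) - (j + i)) :=
              mul_le_mul_of_nonneg_left (by omega) hg.s_pos.le
            have h3 := hg.s_pos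
            refine add_mem (R.filt_mono g s ?_ h1)
              (Submodule.smul_mem _ _ (R.word_mem_filt g s ?_))
            · simp only [deg, hrev]; push_cast; linarith
            · simp only [deg, hrev]; linarith
      · rw [T.lie_e_f_of_eq b a hab.symm (Ne.symm hab'), if_neg (by simp [hab'])]; simp
    · -- the bracket is a combination of negative root vectors of smaller height
      have hne : (a, i) ≠ (b, j.rev) := fun h => by
        rw [Prod.mk.injEq] at h; rw [h.1] at hab; exact lt_irrefl _ hab
      rw [if_neg hne, smul_zero, sub_zero]
      refine R.ρ_span_f_mem_filt g s (n := T.ht a - T.ht b)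
        (fun c (hc : T.ht c + T.ht b = T.ht a) => by omega) (T.lie_e_f_of_lt b a hab)
        (fun _ _ => ?_) (R.word_mem_filt g s le_rfl)
      have h4 := hg.superadd (T.ht a - T.ht b) (T.ht b) a (by omega)
      rw [Nat.sub_add_cancel hab.le] at h4
      simp only [deg, hrev]
      push_cast
      linarith

end HighestWeightRep

namespace HighestWeightRep

variable {K L Φ : Type*} [Field K] [LieRing L] [LieAlgebra K L]
  {T : TriangularVectors K L Φ} {N : ℕ} {M : Type*} [AddCommGroup M] [Module K M]
  (R : HighestWeightRep T N M) {g : ℕ → ℤ} {s : ℤ} [DecidableEq Φ]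

variable (g s) in
lemma sum_Y_pderiv_cons [Fintype Φ] (l : List (Φ × Fin (N + 1))) (p : Φ × Fin (N + 1)) :
    ∑ q, deg (T := T) g s q • R.Y q (R.pderiv q (p :: l)) =
      deg (T := T) g s p • R.word (p :: l) +
        ∑ q, deg (T := T) g s q • R.Y q (R.Y p (R.pderiv q l)) := by
  simp only [pderiv, map_add, smul_add, Finset.sum_add_distrib]
  congr 1
  rw [Finset.sum_eq_single p]
  · simp
  · intro q _ hq; simp [hq.symm]
  · simp

/-- Euler's identity, to leading order. -/
lemma euler_word [Fintype Φ] (hg : IsAdapted T N g s) (l : List (Φ × Fin (N + 1))) :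
    ∑ q, deg (T := T) g s q • R.Y q (R.pderiv q l) -
      (l.map (deg (T := T) g s)).sum • R.word l ∈
      R.filt g s ((l.map (deg (T := T) g s)).sum - 1) := by
  induction l with
  | nil => simp [pderiv]
  | cons p l ih =>
    have key : ∑ q, deg (T := T) g s q • R.Y q (R.pderiv q (p :: l)) -
        ((p :: l).map (deg (T := T) g s)).sum • R.word (p :: l) =
        ∑ q, deg (T := T) g s q •
          (R.Y q (R.Y p (R.pderiv q l)) - R.Y p (R.Y q (R.pderiv q l))) +
        R.Y p (∑ q, deg (T := T) g s q • R.Y q (R.pderiv q l) -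
          (l.map (deg (T := T) g s)).sum • R.word l) := by
      rw [sum_Y_pderiv_cons, map_sub, map_sum, map_zsmul]
      simp only [map_zsmul, smul_sub, Finset.sum_sub_distrib, List.map_cons, List.sum_cons,
        add_smul, word_cons]
      abel
    rw [key]
    refine add_mem (sum_mem fun q _ => zsmul_mem (R.filt_mono g s ?_
      (R.Y_swap_mem_filt hg q p (R.pderiv_mem_filt (g := g) (s := s) q l))) _)
      (R.filt_mono g s ?_ (R.Y_mem_filt g s p ih))
    · simp only [List.map_cons, List.sum_cons]; linarith
    · simp only [List.map_cons, List.sum_cons]; linarith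

/-- If the last component of the highest weight is regular, then a vector that the raising operators
send to lower weight than expected is itself of lower weight.  The Euler operator, which they
express, would otherwise multiply its leading part by the nonzero number `D`. -/
lemma mem_filt_sub_one [CharZero K] [Fintype Φ] (hg : IsAdapted T N g s)
    (hreg : ∀ a, R.wt N ⁅T.e a, T.f a⁆ ≠ 0) {D : ℤ} (hD : D ≠ 0) {m : M} (hm : m ∈ R.filt g s D)
    (he : ∀ (b : Φ) (j : Fin (N + 1)),
      R.ρ j (T.e b) m ∈ R.filt g s (D - deg (T := T) g s (b, j.rev) - 1)) :
    m ∈ R.filt g s (D - 1) := by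
  let Θ : Module.End K M := ∑ q : Φ × Fin (N + 1), deg (T := T) g s q •
    (R.wt N ⁅T.e q.1, T.f q.1⁆)⁻¹ • (R.Y q * R.ρ q.2.rev (T.e q.1))
  have hΘ : Θ m ∈ R.filt g s (D - 1) := by
    simp only [Θ, LinearMap.sum_apply, LinearMap.smul_apply, Module.End.mul_apply]
    refine sum_mem fun q _ => zsmul_mem (Submodule.smul_mem _ _ ?_) _
    have h := R.Y_mem_filt g s q (he q.1 q.2.rev)
    rw [Fin.rev_rev] at h
    exact R.filt_mono g s (by linarith) h
  have hE : (Θ - D • (1 : Module.End K M)) m ∈ R.filt g s (D - 1) := by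
    refine R.map_mem_of_word g s (fun l hl => ?_) hm
    set Dl := (l.map (deg (T := T) g s)).sum with hDl
    have key : (Θ - D • (1 : Module.End K M)) (R.word l) =
        ∑ q : Φ × Fin (N + 1), deg (T := T) g s q • (R.wt N ⁅T.e q.1, T.f q.1⁆)⁻¹ •
          R.Y q (R.ρ q.2.rev (T.e q.1) (R.word l) -
            R.wt N ⁅T.e q.1, T.f q.1⁆ • R.pderiv q l) +
        (∑ q, deg (T := T) g s q • R.Y q (R.pderiv q l) - Dl • R.word l) +
        (Dl - D) • R.word l := by
      simp only [Θ, LinearMap.sub_apply, LinearMap.sum_apply, LinearMap.smul_apply,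
        Module.End.mul_apply, Module.End.one_apply, map_sub, map_smul, smul_sub,
        Finset.sum_sub_distrib, inv_smul_smul₀ (hreg _), sub_smul]
      abel
    rw [key]
    refine add_mem (add_mem (sum_mem fun q _ => zsmul_mem (Submodule.smul_mem _ _ ?_) _) ?_) ?_
    · have h := R.Y_mem_filt g s q (R.ρ_e_word hg l q.1 q.2.rev)
      rw [Fin.rev_rev] at h
      exact R.filt_mono g s (by linarith) h
    · exact R.filt_mono g s (by linarith) (R.euler_word hg l)
    · rcases hl.eq_or_lt with h | h
      · rw [h]; simp
      · exact zsmul_mem (R.word_mem_filt g s (by omega)) _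
  have h := sub_mem hΘ hE
  have h' : (D : K) • m ∈ R.filt g s (D - 1) := by
    rw [Int.cast_smul_eq_zsmul]
    simpa using h
  exact (Submodule.smul_mem_iff _ (by exact_mod_cast hD)).mp h'

omit [DecidableEq Φ] in
lemma deg_pos (hg : IsAdapted T N g s) (p : Φ × Fin (N + 1)) : 0 < deg (T := T) g s p := by
  have h1 := hg.lt_g p.1
  have h2 : s * (p.2 : ℕ) ≤ s * N :=
    mul_le_mul_of_nonneg_left (by have := p.2.2; omega) hg.s_pos.le
  simp only [deg]
  linarith

omit [DecidableEq Φ] in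
lemma sum_deg_nonneg (hg : IsAdapted T N g s) (l : List (Φ × Fin (N + 1))) :
    0 ≤ (l.map (deg (T := T) g s)).sum :=
  List.sum_nonneg (by
    intro x hx
    obtain ⟨p, -, rfl⟩ := List.mem_map.mp hx
    exact (deg_pos hg p).le)

omit [DecidableEq Φ] in
lemma filt_zero_le (hg : IsAdapted T N g s) : R.filt g s 0 ≤ K ∙ R.v := by
  refine Submodule.span_le.mpr ?_
  rintro _ ⟨l, hl, rfl⟩
  cases l with
  | nil => exact Submodule.mem_span_singleton_self _
  | cons p l =>
    have h1 := deg_pos hg p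
    have h2 := sum_deg_nonneg hg l
    simp only [List.map_cons, List.sum_cons] at hl
    omega

omit [DecidableEq Φ] in
lemma filt_eq_bot (hg : IsAdapted T N g s) {D : ℤ} (hD : D < 0) : R.filt g s D = ⊥ := by
  refine Submodule.span_eq_bot.mpr ?_
  rintro _ ⟨l, hl, rfl⟩
  have := sum_deg_nonneg hg l
  omega

/-- The filtration by weight exhausts the module. -/
lemma exists_mem_filt (hg : IsAdapted T N g s) (m : M) : ∃ D, m ∈ R.filt g s D := by
  let S : Submodule K M := ⨆ D, R.filt g s D
  have hdir : Directed (· ≤ ·) (R.filt g s) := Monotone.directed_le fun _ _ h => R.filt_mono g s h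
  have hmem (m : M) : m ∈ S ↔ ∃ D, m ∈ R.filt g s D := Submodule.mem_iSup_of_directed _ hdir
  have hS : S = ⊤ := by
    refine R.cyclic S ((hmem _).mpr ⟨0, R.word_mem_filt g s (l := []) le_rfl⟩) fun i x m hm => ?_
    by_cases hi : N < i
    · rw [R.trunc i hi]; simp
    obtain ⟨D, hD⟩ := (hmem m).mp hm
    have hx : x ∈ Submodule.span K (Set.range T.f) ⊔ T.H ⊔ Submodule.span K (Set.range T.e) := by
      rw [T.span_eq_top]; trivial
    have hf (x : L) (hx : x ∈ Submodule.span K (Set.range T.f)) : R.ρ i x m ∈ S := by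
      induction hx using Submodule.span_induction with
      | mem x hx =>
        obtain ⟨a, rfl⟩ := hx
        exact (hmem _).mpr ⟨_, R.Y_mem_filt g s (a, ⟨i, by omega⟩) hD⟩
      | zero => simp
      | add x y _ _ hx hy => rw [map_add]; exact add_mem hx hy
      | smul c x _ hx => rw [map_smul]; exact Submodule.smul_mem _ _ hx
    have he (x : L) (hx : x ∈ Submodule.span K (Set.range T.e)) : R.ρ i x m ∈ S := by
      induction hx using Submodule.span_induction with
      | mem x hx =>
        obtain ⟨a, rfl⟩ := hx
        refine R.map_mem_of_word g s (fun l _ => ?_) hD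
        have h1 := R.ρ_e_word hg l a ⟨i, by omega⟩
        have h2 := R.pderiv_mem_filt (g := g) (s := s) (a, Fin.rev ⟨i, by omega⟩) l
        have h3 := add_mem (R.filt_mono g s (sub_le_self _ zero_le_one) h1)
          (Submodule.smul_mem _ (R.wt N ⁅T.e a, T.f a⁆) h2)
        rw [sub_add_cancel] at h3
        exact (hmem _).mpr ⟨_, h3⟩
      | zero => simp
      | add x y _ _ hx hy => rw [map_add]; exact add_mem hx hy
      | smul c x _ hx => rw [map_smul]; exact Submodule.smul_mem _ _ hx
    have hh (x : L) (hx : x ∈ T.H) : R.ρ i x m ∈ S := by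
      refine R.map_mem_of_word g s (fun l _ => ?_) hD
      have h1 := R.ρ_cartan_word hg hx i l
      rw [← sub_add_cancel (R.ρ i x (R.word l)) (R.wt i x • R.word l)]
      exact add_mem ((hmem _).mpr ⟨_, h1⟩)
        (Submodule.smul_mem _ _ ((hmem _).mpr ⟨_, R.word_mem_filt g s le_rfl⟩))
    obtain ⟨y, hy, z, hz, rfl⟩ := Submodule.mem_sup.mp hx
    obtain ⟨y₁, hy₁, y₂, hy₂, rfl⟩ := Submodule.mem_sup.mp hy
    rw [map_add, map_add]
    exact add_mem (add_mem (hf _ hy₁) (hh _ hy₂)) (he _ hz)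
  exact (hmem m).mp (hS ▸ Submodule.mem_top)

/-- If the last component of the highest weight is regular, then every nonzero stable subspace
contains the highest weight vector. -/
theorem v_mem_of_regular_of_isAdapted [CharZero K] [Fintype Φ] (hg : IsAdapted T N g s)
    (hreg : ∀ a, R.wt N ⁅T.e a, T.f a⁆ ≠ 0) (S : Submodule K M)
    (hS : ∀ i x, ∀ m ∈ S, R.ρ i x m ∈ S) (hS0 : S ≠ ⊥) : R.v ∈ S := by
  have main : ∀ n : ℕ, ∀ m ∈ S, m ≠ 0 → m ∈ R.filt g s n → R.v ∈ S := by
    intro n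
    induction n using Nat.strong_induction_on with
    | _ n ih =>
      intro m hm hm0 hmn
      have lower (x : M) (hx : x ∈ S) (hx0 : x ≠ 0) (D : ℤ) (hD : D < n)
          (hxD : x ∈ R.filt g s D) : R.v ∈ S := by
        rcases lt_or_ge D 0 with h | h
        · rw [R.filt_eq_bot hg h] at hxD; exact absurd hxD hx0
        · lift D to ℕ using h
          exact ih D (by omega) x hx hx0 hxD
      rcases Nat.eq_zero_or_pos n with rfl | hn
      · obtain ⟨c, rfl⟩ := Submodule.mem_span_singleton.mp (R.filt_zero_le hg hmn)
        have hc : c ≠ 0 := by rintro rfl; simp at hm0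
        exact (Submodule.smul_mem_iff _ hc).mp hm
      by_cases hm1 : m ∈ R.filt g s ((n : ℤ) - 1)
      · exact lower m hm hm0 _ (by omega) hm1
      have hex : ∃ (b : Φ) (j : Fin (N + 1)),
          R.ρ j (T.e b) m ∉ R.filt g s (n - deg (T := T) g s (b, j.rev) - 1) := by
        by_contra! hcon
        exact hm1 (R.mem_filt_sub_one hg hreg (by omega) hmn hcon)
      obtain ⟨b, j, hbj⟩ := hex
      refine lower _ (hS j (T.e b) m hm) (fun h => hbj (h ▸ zero_mem _))
        (n - deg (T := T) g s (b, j.rev)) (by linarith [deg_pos hg (b, j.rev)])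
        (R.map_mem_of_word g s (fun l hl => ?_) hmn)
      have h1 := R.ρ_e_word hg l b j
      have h2 := R.pderiv_mem_filt (g := g) (s := s) (b, j.rev) l
      have h3 := add_mem (R.filt_mono g s (sub_le_self _ zero_le_one) h1)
        (Submodule.smul_mem _ (R.wt N ⁅T.e b, T.f b⁆) h2)
      rw [sub_add_cancel] at h3
      exact R.filt_mono g s (by linarith) h3
  obtain ⟨m, hm, hm0⟩ := Submodule.exists_mem_ne_zero_of_ne_bot hS0
  obtain ⟨D, hD⟩ := R.exists_mem_filt hg m
  exact main D.toNat m hm hm0 (R.filt_mono g s (Int.self_le_toNat D) hD)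

omit [DecidableEq Φ] in
/-- Adapted weights exist: `g h = C * h - h ^ 2` is strictly subadditive, the slope `s` outweighs
its failure to be superadditive, and `C` makes it positive. -/
lemma exists_isAdapted [Finite Φ] (T : TriangularVectors K L Φ) {N : ℕ} (hN : 0 < N) :
    ∃ g s, IsAdapted T N g s := by
  obtain ⟨B, hB⟩ := (Set.finite_range T.ht).bddAbove
  have hB' (a : Φ) : (T.ht a : ℤ) ≤ B := by exact_mod_cast hB ⟨a, rfl⟩
  set s : ℤ := 2 * B ^ 2 + 1 with hs
  have hs0 : 0 < s := by positivity
  have hN' : (1 : ℤ) ≤ N := by exact_mod_cast hN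
  refine ⟨fun h => (B + s * N + 1) * h - h ^ 2, s, hs0, hN, fun m n hm hn => ?_,
    fun m n a h => ?_, fun a => ?_⟩
  · have : (1 : ℤ) ≤ m * n := by exact_mod_cast Nat.mul_pos hm hn
    push_cast
    linarith
  · have h1 : (m : ℤ) + n ≤ B := by exact_mod_cast h ▸ hB ⟨a, rfl⟩
    have h2 : (m : ℤ) * n ≤ B ^ 2 := by
      rw [sq]
      exact mul_le_mul (by omega) (by omega) (by omega) (by omega)
    have h3 : s * 1 ≤ s * N := mul_le_mul_of_nonneg_left hN' hs0.le
    push_cast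
    linarith
  · have h1 : (1 : ℤ) ≤ T.ht a := by exact_mod_cast T.ht_pos a
    have h2 := hB' a
    have h3 : 0 ≤ s * N := by positivity
    nlinarith

omit [DecidableEq Φ] in
/-- If the last component of the highest weight is regular, then every nonzero stable subspace
contains the highest weight vector. -/
theorem v_mem_of_regular [CharZero K] [Finite Φ] (hN : 0 < N)
    (hreg : ∀ a, R.wt N ⁅T.e a, T.f a⁆ ≠ 0) (S : Submodule K M)
    (hS : ∀ i x, ∀ m ∈ S, R.ρ i x m ∈ S) (hS0 : S ≠ ⊥) : R.v ∈ S := by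
  classical
  have := Fintype.ofFinite Φ
  obtain ⟨g, s, hg⟩ := exists_isAdapted T hN
  exact R.v_mem_of_regular_of_isAdapted hg hreg S hS hS0

end HighestWeightRep

/-! ### Straightening of words -/

section Straightening

variable {K A ι : Type*} [CommRing K] [Ring A] [Algebra K A] (z : ι → A) (ht : ι → ℕ)

variable (K) in
/-- The span of the nonempty words in the `z i` of length less than `n` and total height `d`. -/
def shortWords (n d : ℕ) : Submodule K A :=
  Submodule.span K {x | ∃ l : List ι, l ≠ [] ∧ l.length < n ∧ (l.map ht).sum = d ∧
    x = (l.map z).prod}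

lemma mul_mem_shortWords (i : ι) {n d : ℕ} {x : A} (hx : x ∈ shortWords K z ht n d) :
    z i * x ∈ shortWords K z ht (n + 1) (ht i + d) := by
  have : shortWords K z ht n d ≤
      (shortWords K z ht (n + 1) (ht i + d)).comap (LinearMap.mulLeft K (z i)) := by
    refine Submodule.span_le.mpr ?_
    rintro _ ⟨l, -, hl, hd, rfl⟩
    exact Submodule.subset_span ⟨i :: l, by simp, by simpa using hl, by simp [hd], by simp⟩
  exact this hx

variable {z ht}

/-- Permuting the factors of a word changes it by shorter words. -/
lemma prod_sub_prod_mem_shortWords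
    (hz : ∀ i j, z i * z j - z j * z i ∈ Submodule.span K (z '' {k | ht k = ht i + ht j}))
    {l l' : List ι} (h : l.Perm l') :
    (l.map z).prod - (l'.map z).prod ∈ shortWords K z ht l.length (l.map ht).sum := by
  induction h with
  | nil => simp
  | cons i _ ih =>
    simp only [List.map_cons, List.prod_cons, ← mul_sub, List.length_cons, List.sum_cons]
    exact mul_mem_shortWords z ht i ih
  | swap i j l =>
    simp only [List.map_cons, List.prod_cons, ← mul_assoc, ← sub_mul]
    have : Submodule.span K (z '' {k | ht k = ht j + ht i}) ≤
        (shortWords K z ht (j :: i :: l).length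
          ((j :: i :: l).map ht).sum).comap (LinearMap.mulRight K (l.map z).prod) := by
      refine Submodule.span_le.mpr ?_
      rintro _ ⟨k, hk, rfl⟩
      refine Submodule.subset_span ⟨k :: l, by simp, by simp, ?_, by simp⟩
      simp only [List.map_cons, List.sum_cons, show ht k = ht j + ht i from hk, add_assoc]
    exact this (hz j i)
  | trans h₁ h₂ ih₁ ih₂ =>
    rw [← h₁.length_eq, ← (h₁.map ht).sum_eq] at ih₂
    rw [← sub_add_sub_cancel]
    exact add_mem ih₁ ih₂

/-- Words are combinations of the words `can m` chosen one for each multiset `m`. -/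
lemma prod_mem_span_canonical
    (hz : ∀ i j, z i * z j - z j * z i ∈ Submodule.span K (z '' {k | ht k = ht i + ht j}))
    (can : Multiset ι → List ι) (hcan : ∀ m, (can m : Multiset ι) = m) (l : List ι) :
    (l.map z).prod ∈ Submodule.span K {x | ∃ m : Multiset ι, (l ≠ [] → m ≠ 0) ∧
      (m.map ht).sum = (l.map ht).sum ∧ x = ((can m).map z).prod} := by
  induction hn : l.length using Nat.strong_induction_on generalizing l with
  | _ n ih =>
    subst hn
    have hperm : l.Perm (can l) := Multiset.coe_eq_coe.mp (hcan _).symm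
    rw [← sub_add_cancel (l.map z).prod ((can l).map z).prod]
    refine add_mem ?_ (Submodule.subset_span ⟨l, by simp, by simp, rfl⟩)
    refine (Submodule.span_le.mpr ?_ : shortWords K z ht l.length (l.map ht).sum ≤ _)
      (prod_sub_prod_mem_shortWords hz hperm)
    rintro _ ⟨l', hl', hlen, hd, rfl⟩
    refine Submodule.span_mono ?_ (ih _ hlen l' rfl)
    rintro _ ⟨m, hm, hd', rfl⟩
    exact ⟨m, fun _ => hm hl', hd'.trans hd, rfl⟩

end Straightening

namespace HighestWeightRep

variable {K L Φ : Type*} [Field K] [LieRing L] [LieAlgebra K L]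
  {T : TriangularVectors K L Φ} {N : ℕ} {M : Type*} [AddCommGroup M] [Module K M]
  (R : HighestWeightRep T N M)

lemma span_range_word [Finite Φ] (hN : 0 < N) : Submodule.span K (Set.range R.word) = ⊤ := by
  classical
  obtain ⟨g, s, hg⟩ := exists_isAdapted T hN
  refine eq_top_iff.mpr fun m _ => ?_
  obtain ⟨D, hD⟩ := R.exists_mem_filt hg m
  exact Submodule.span_mono (by rintro _ ⟨l, -, rfl⟩; exact ⟨l, rfl⟩) hD

/-! ### Singular highest weights: a proper nonzero submodule -/

/-- The operator by which `t ^ i ⊗ e a` acts. -/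
def E (p : Φ × Fin (N + 1)) : Module.End K M := R.ρ p.2 (T.e p.1)

/-- The vectors at which a functional vanishes after any sequence of raising operators. -/
def radical (φ : M →ₗ[K] K) : Submodule K M where
  carrier := {m | ∀ l : List (Φ × Fin (N + 1)), φ ((l.map R.E).prod m) = 0}
  add_mem' hx hy l := by rw [map_add, map_add, hx l, hy l, add_zero]
  zero_mem' l := by rw [map_zero, map_zero]
  smul_mem' c x hx l := by rw [map_smul, map_smul, hx l, smul_zero]

variable {φ : M →ₗ[K] K}

lemma φ_ρ_cartan [Finite Φ] (hN : 0 < N) (hφ : ∀ p m, φ (R.Y p m) = 0) (i : ℕ) {h : L}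
    (hh : h ∈ T.H) (m : M) : φ (R.ρ i h m) = R.wt i h * φ m := by
  have : φ ∘ₗ R.ρ i h = R.wt i h • φ := by
    refine LinearMap.ext_on (R.span_range_word hN) ?_
    rintro _ ⟨l, rfl⟩
    cases l with
    | nil => simp [R.ρ_cartan_v i h hh]
    | cons p l =>
      obtain ⟨c, hc⟩ := T.lie_cartan_f h hh p.1
      simp only [LinearMap.comp_apply, LinearMap.smul_apply, word_cons, hφ, smul_zero]
      rw [Y, R.comm, hc, map_add, ← Y, hφ, zero_add, map_smul, LinearMap.smul_apply, map_smul]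
      by_cases hi : i + p.2 ≤ N
      · have := hφ (p.1, ⟨i + p.2, by omega⟩) (R.word l)
        rw [Y] at this
        rw [this, smul_zero]
      · rw [R.trunc _ (by omega)]; simp
  exact LinearMap.congr_fun this m

/-- The radical of a functional that vanishes on the image of the lowering operators is stable
under the whole algebra. -/
lemma ρ_mem_radical [Finite Φ] (hN : 0 < N) (hφ : ∀ p m, φ (R.Y p m) = 0) (i : ℕ) (x : L) {m : M}
    (hm : m ∈ R.radical φ) : R.ρ i x m ∈ R.radical φ := by
  intro l
  -- the operator is moved to the right end of the word, where any element of the algebra acts by 0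
  induction l using List.reverseRecOn generalizing i x m with
  | append_singleton l p ih =>
    have hp : R.E p m ∈ R.radical φ := fun l => by
      simpa using hm (l ++ [p])
    have hxp := ih i x hp
    rw [E] at hxp
    rw [List.map_append, List.prod_append, List.map_singleton, List.prod_singleton,
      Module.End.mul_apply, E, R.comm, map_add, map_add, hxp, ih _ _ hm, add_zero]
  | nil =>
    by_cases hi : N < i
    · rw [R.trunc i hi]; simp
    have hx : x ∈ Submodule.span K (Set.range T.f) ⊔ T.H ⊔ Submodule.span K (Set.range T.e) := by
      rw [T.span_eq_top]; trivial
    change φ (R.ρ i x m) = 0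
    let S : Submodule K L := LinearMap.ker (φ ∘ₗ (LinearMap.applyₗ m) ∘ₗ R.ρ i)
    suffices h : Submodule.span K (Set.range T.f) ⊔ T.H ⊔ Submodule.span K (Set.range T.e) ≤ S from
      h hx
    refine sup_le (sup_le (Submodule.span_le.mpr ?_) ?_) (Submodule.span_le.mpr ?_)
    · rintro _ ⟨a, rfl⟩
      exact hφ (a, ⟨i, by omega⟩) m
    · intro h hh
      have h1 : φ m = 0 := by simpa using hm []
      exact (R.φ_ρ_cartan hN hφ i hh m).trans (by rw [h1, mul_zero])
    · rintro _ ⟨a, rfl⟩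
      change φ (R.ρ i (T.e a) m) = 0
      simpa [E] using hm [(a, ⟨i, by omega⟩)]

/-- A word in the lowering operators `t ^ N ⊗ f a`, which commute with each other. -/
def topWord (l : List Φ) : M := R.word (l.map fun a => (a, Fin.last N))

@[simp] lemma topWord_nil : R.topWord [] = R.v := rfl

lemma topWord_cons (a : Φ) (l : List Φ) :
    R.topWord (a :: l) = R.ρ N (T.f a) (R.topWord l) := rfl

/-- The words in the `t ^ N ⊗ f a` do not depend on the order of their letters. -/
lemma topWord_perm (hN : 0 < N) {l l' : List Φ} (h : l.Perm l') :
    R.topWord l = R.topWord l' := by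
  induction h with
  | nil => rfl
  | cons a _ ih => rw [topWord_cons, topWord_cons, ih]
  | swap a c l =>
    rw [topWord_cons, topWord_cons, topWord_cons, topWord_cons, R.comm, R.trunc (N + N) (by omega)]
    simp
  | trans _ _ h₁ h₂ => exact h₁.trans h₂

/-- The span of the words in the `t ^ N ⊗ f a` of total height `n`. -/
def topSpan (n : ℤ) : Submodule K M :=
  Submodule.span K {m | ∃ l : List Φ, (((l.map T.ht).sum : ℕ) : ℤ) = n ∧ m = R.topWord l}

lemma topWord_mem_topSpan (l : List Φ) : R.topWord l ∈ R.topSpan ((l.map T.ht).sum : ℕ) :=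
  Submodule.subset_span ⟨l, rfl, rfl⟩

lemma map_mem_of_topWord {n : ℤ} {ψ : Module.End K M} {S : Submodule K M}
    (h : ∀ l : List Φ, (((l.map T.ht).sum : ℕ) : ℤ) = n → ψ (R.topWord l) ∈ S)
    {m : M} (hm : m ∈ R.topSpan n) : ψ m ∈ S := by
  have : R.topSpan n ≤ S.comap ψ := Submodule.span_le.mpr (by
    rintro _ ⟨l, hl, rfl⟩
    exact h l hl)
  exact this hm

lemma ρ_f_mem_topSpan (a : Φ) {n : ℤ} {m : M} (hm : m ∈ R.topSpan n) :
    R.ρ N (T.f a) m ∈ R.topSpan (n + T.ht a) := by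
  refine R.map_mem_of_topWord (fun l hl => ?_) hm
  rw [← R.topWord_cons]
  convert R.topWord_mem_topSpan (a :: l) using 2
  rw [← hl]
  simp [add_comm]

lemma ρ_e_topWord_of_pos (j : ℕ) (hj : 0 < j) (b : Φ) (l : List Φ) :
    R.ρ j (T.e b) (R.topWord l) = 0 := by
  induction l with
  | nil => exact R.ρ_e_v j b
  | cons a l ih =>
    rw [topWord_cons, R.comm, ih, R.trunc (j + N) (by omega)]
    simp

lemma ρ_cartan_topWord (hN : 0 < N) {h : L} (hh : h ∈ T.H) (l : List Φ) :
    R.ρ N h (R.topWord l) = R.wt N h • R.topWord l := by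
  induction l with
  | nil => exact R.ρ_cartan_v N h hh
  | cons a l ih =>
    rw [topWord_cons, R.comm, ih, R.trunc (N + N) (by omega)]
    simp

lemma ρ_span_e_topWord {S : Set Φ} {x : L} (hx : x ∈ Submodule.span K (T.e '' S)) (hN : 0 < N)
    (l : List Φ) : R.ρ N x (R.topWord l) = 0 := by
  induction hx using Submodule.span_induction with
  | mem x hx => obtain ⟨c, -, rfl⟩ := hx; exact R.ρ_e_topWord_of_pos N hN c l
  | zero => simp
  | add x y _ _ hx hy => rw [map_add, LinearMap.add_apply, hx, hy, add_zero]
  | smul c x _ hx => rw [map_smul, LinearMap.smul_apply, hx, smul_zero]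

lemma ρ_e_topWord_mem (hN : 0 < N) (b : Φ) (l : List Φ) :
    R.ρ 0 (T.e b) (R.topWord l) ∈ R.topSpan (((l.map T.ht).sum : ℕ) - T.ht b) := by
  induction l with
  | nil => simp [R.ρ_e_v]
  | cons a l ih =>
    rw [topWord_cons, R.comm, zero_add]
    have hsum : (((a :: l).map T.ht).sum : ℕ) = (T.ht a : ℤ) + ((l.map T.ht).sum : ℕ) := by simp
    refine add_mem ?_ ?_
    · convert R.ρ_f_mem_topSpan a ih using 2
      rw [hsum]; ring
    · rcases lt_trichotomy (T.ht a) (T.ht b) with hab | hab | hab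
      · rw [R.ρ_span_e_topWord (T.lie_e_f_of_gt b a hab) hN]
        exact zero_mem _
      · by_cases h : a = b
        · subst h
          rw [R.ρ_cartan_topWord hN (T.lie_e_f_self a), hsum, add_sub_cancel_left]
          exact Submodule.smul_mem _ _ (R.topWord_mem_topSpan l)
        · rw [T.lie_e_f_of_eq b a hab.symm (Ne.symm h)]; simp
      · have hmem := T.lie_e_f_of_lt b a hab
        generalize ⁅T.e b, T.f a⁆ = x at hmem
        induction hmem using Submodule.span_induction with
        | mem x hx =>
          obtain ⟨c, hc, rfl⟩ := hx
          convert R.ρ_f_mem_topSpan c (R.topWord_mem_topSpan l) using 2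
          rw [hsum, ← show T.ht c + T.ht b = T.ht a from hc]
          push_cast; ring
        | zero => simp
        | add x y _ _ hx hy => rw [map_add]; exact add_mem hx hy
        | smul c x _ hx => rw [map_smul]; exact Submodule.smul_mem _ _ hx

/-- If `⁅e a, f a⁆` has value zero, then `e a` sends the words of height `ht a` to vectors at which
the functional vanishes. -/
lemma φ_ρ_e_topWord (hN : 0 < N) (hφ : ∀ p m, φ (R.Y p m) = 0) {a : Φ}
    (ha : R.wt N ⁅T.e a, T.f a⁆ = 0) {l : List Φ} (hl : (l.map T.ht).sum = T.ht a) :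
    φ (R.ρ 0 (T.e a) (R.topWord l)) = 0 := by
  cases l with
  | nil => simp [R.ρ_e_v]
  | cons c l =>
    have h1 : φ (R.ρ N (T.f c) (R.ρ 0 (T.e a) (R.topWord l))) = 0 := hφ (c, Fin.last N) _
    rw [topWord_cons, R.comm, zero_add, map_add, h1, zero_add]
    simp only [List.map_cons, List.sum_cons] at hl
    rcases lt_or_eq_of_le (show T.ht c ≤ T.ht a by omega) with hca | hca
    · rw [R.ρ_span_e_topWord (T.lie_e_f_of_gt a c hca) hN, map_zero]
    · by_cases h : c = a
      · subst h
        rw [R.ρ_cartan_topWord hN (T.lie_e_f_self c), ha, zero_smul, map_zero]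
      · rw [T.lie_e_f_of_eq a c hca.symm (Ne.symm h)]; simp

lemma φ_topSpan (hφ : ∀ p m, φ (R.Y p m) = 0) {n : ℤ} (hn : n ≠ 0) {m : M}
    (hm : m ∈ R.topSpan n) : φ m = 0 := by
  refine (Submodule.span_le.mpr ?_ : R.topSpan n ≤ LinearMap.ker φ) hm
  rintro _ ⟨l, hl, rfl⟩
  cases l with
  | nil => simp at hl; exact absurd hl.symm hn
  | cons a l => exact hφ (a, Fin.last N) _

lemma prod_ρ_e_mem_topSpan (hN : 0 < N) (l : List Φ) {n : ℤ} {m : M} (hm : m ∈ R.topSpan n) :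
    (l.map fun b => R.ρ 0 (T.e b)).prod m ∈ R.topSpan (n - ((l.map T.ht).sum : ℕ)) := by
  induction l with
  | nil => simpa using hm
  | cons b l ih =>
    simp only [List.map_cons, List.prod_cons, Module.End.mul_apply, List.sum_cons]
    refine R.map_mem_of_topWord (fun l' hl' => ?_) ih
    convert R.ρ_e_topWord_mem hN b l' using 2
    rw [hl']; push_cast; ring

/-- A word of raising operators that involves a positive power of `t` kills `topSpan n`. -/
lemma prod_E_topSpan (hN : 0 < N) (l : List (Φ × Fin (N + 1))) (hl : ∃ p ∈ l, p.2 ≠ 0)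
    {n : ℤ} {m : M} (hm : m ∈ R.topSpan n) : (l.map R.E).prod m = 0 := by
  have key (l : List (Φ × Fin (N + 1))) : ∃ n', (l.map R.E).prod m ∈ R.topSpan n' := by
    induction l with
    | nil => exact ⟨n, by simpa using hm⟩
    | cons p l ih =>
      obtain ⟨n', hn'⟩ := ih
      simp only [List.map_cons, List.prod_cons, Module.End.mul_apply]
      refine ⟨n' - T.ht p.1, R.map_mem_of_topWord (fun l' hl' => ?_) hn'⟩
      by_cases hp : p.2 = 0
      · rw [E, hp, ← hl']; exact R.ρ_e_topWord_mem hN p.1 l'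
      · rw [E, R.ρ_e_topWord_of_pos _ (Nat.pos_of_ne_zero fun h => hp (Fin.ext h))]
        exact zero_mem _
  obtain ⟨p, hp, hp0⟩ := hl
  obtain ⟨l₁, l₂, rfl⟩ := List.append_of_mem hp
  obtain ⟨n', hn'⟩ := key l₂
  rw [List.map_append, List.map_cons, List.prod_append, List.prod_cons, Module.End.mul_apply,
    Module.End.mul_apply]
  have : R.E p ((l₂.map R.E).prod m) ∈ (⊥ : Submodule K M) :=
    R.map_mem_of_topWord (fun l' _ => by
      rw [E, R.ρ_e_topWord_of_pos _ (Nat.pos_of_ne_zero fun h => hp0 (Fin.ext h))]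
      exact zero_mem _) hn'
  rw [(Submodule.mem_bot K).mp this, map_zero]

lemma finite_multiset_ht [Finite Φ] (T : TriangularVectors K L Φ) (n : ℕ) :
    Finite {m : Multiset Φ // (m.map T.ht).sum = n} := by
  classical
  have hcount (m : {m : Multiset Φ // (m.map T.ht).sum = n}) (b : Φ) : m.1.count b < n + 1 := by
    have h1 : m.1.card ≤ (m.1.map T.ht).sum := by
      have := Multiset.card_nsmul_le_sum (s := m.1.map T.ht) (a := 1) (by
        intro x hx
        obtain ⟨c, -, rfl⟩ := Multiset.mem_map.mp hx
        exact T.ht_pos c)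
      simpa using this
    have := m.1.count_le_card b
    have := m.2
    omega
  refine Finite.of_injective
    (fun (m : {m : Multiset Φ // (m.map T.ht).sum = n}) b =>
      (⟨m.1.count b, hcount m b⟩ : Fin (n + 1)))
    fun m m' h => Subtype.ext (Multiset.ext.mpr fun b => ?_)
  exact congrArg Fin.val (congrFun h b)

/-- If the last component of the highest weight vanishes on `⁅e a, f a⁆` and the lowering operators
act freely enough, then there is a proper nonzero stable subspace. -/
theorem exists_stable_of_singular [Finite Φ] (hN : 0 < N) (hφ : ∀ p m, φ (R.Y p m) = 0)
    (hv : φ R.v = 1) (hind : LinearIndependent K fun m : Multiset Φ => R.topWord m.toList) {a : Φ}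
    (ha : R.wt N ⁅T.e a, T.f a⁆ = 0) :
    ∃ S : Submodule K M, (∀ i x, ∀ m ∈ S, R.ρ i x m ∈ S) ∧ S ≠ ⊥ ∧ S ≠ ⊤ := by
  classical
  have := finite_multiset_ht T (T.ht a)
  have := Fintype.ofFinite {m : Multiset Φ // (m.map T.ht).sum = T.ht a}
  let E₀ (l : List Φ) : Module.End K M := (l.map fun b => R.ρ 0 (T.e b)).prod
  -- the pairing of the words of height `ht a` in the raising and in the lowering operators is a
  -- square matrix, and its row at `e a` is zero
  let B : Matrix {m : Multiset Φ // (m.map T.ht).sum = T.ht a}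
    {m : Multiset Φ // (m.map T.ht).sum = T.ht a} K :=
    fun k k' => φ (E₀ k.1.toList (R.topWord k'.1.toList))
  have hB : B.det = 0 := by
    refine Matrix.det_eq_zero_of_row_eq_zero ⟨{a}, by simp⟩ fun k => ?_
    simp only [B, E₀, Multiset.toList_singleton, List.map_singleton, List.prod_singleton]
    refine R.φ_ρ_e_topWord hN hφ ha ?_
    rw [← Multiset.sum_coe, ← Multiset.map_coe, Multiset.coe_toList, k.2]
  obtain ⟨c, hc0, hc⟩ := Matrix.exists_mulVec_eq_zero_iff.mpr hB
  let w : M := ∑ k, c k • R.topWord k.1.toList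
  have hw0 : w ≠ 0 := fun h => hc0 (funext (Fintype.linearIndependent_iff.mp
    (hind.comp _ Subtype.val_injective) c h))
  have hw : w ∈ R.topSpan (T.ht a) := by
    refine sum_mem fun k _ => Submodule.smul_mem _ _ ?_
    convert R.topWord_mem_topSpan k.1.toList using 2
    rw [← Multiset.sum_coe, ← Multiset.map_coe, Multiset.coe_toList, k.2]
  have hpair (k : {m : Multiset Φ // (m.map T.ht).sum = T.ht a}) : φ (E₀ k.1.toList w) = 0 := by
    have h := congrFun hc k
    simp only [Matrix.mulVec, dotProduct, B, Pi.zero_apply] at h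
    simp only [w, map_sum, map_smul, smul_eq_mul]
    rw [← h]
    exact Finset.sum_congr rfl fun _ _ => mul_comm _ _
  have hwQ : w ∈ R.radical φ := by
    intro l
    by_cases hl : ∃ p ∈ l, p.2 ≠ 0
    · rw [R.prod_E_topSpan hN l hl hw, map_zero]
    push Not at hl
    have hl' : l.map R.E = (l.map Prod.fst).map fun b => R.ρ 0 (T.e b) := by
      rw [List.map_map]
      refine List.map_congr_left fun p hp => ?_
      simp [E, hl p hp]
    rw [hl']
    generalize l.map Prod.fst = l
    by_cases hsum : (l.map T.ht).sum = T.ht a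
    · have hcomm (i j : Φ) : R.ρ 0 (T.e i) * R.ρ 0 (T.e j) - R.ρ 0 (T.e j) * R.ρ 0 (T.e i) ∈
          Submodule.span K ((fun b => R.ρ 0 (T.e b)) '' {k | T.ht k = T.ht i + T.ht j}) := by
        have h1 : R.ρ 0 (T.e i) * R.ρ 0 (T.e j) - R.ρ 0 (T.e j) * R.ρ 0 (T.e i) =
            R.ρ 0 ⁅T.e i, T.e j⁆ := by
          ext m
          simp [R.comm 0 0 (T.e i)]
        have h2 := Submodule.mem_map_of_mem (f := R.ρ 0) (T.lie_e_e i j)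
        rw [Submodule.map_span, Set.image_image] at h2
        rw [h1]; exact h2
      have hmem := prod_mem_span_canonical hcomm Multiset.toList Multiset.coe_toList l
      have hle : Submodule.span K {x | ∃ m : Multiset Φ, (l ≠ [] → m ≠ 0) ∧
          (m.map T.ht).sum = (l.map T.ht).sum ∧
          x = (m.toList.map fun b => R.ρ 0 (T.e b)).prod} ≤
          LinearMap.ker (φ ∘ₗ LinearMap.applyₗ w) := by
        refine Submodule.span_le.mpr ?_
        rintro _ ⟨k, -, hk, rfl⟩
        exact hpair ⟨k, hk.trans hsum⟩
      exact hle hmem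
    · exact R.φ_topSpan hφ (by omega) (R.prod_ρ_e_mem_topSpan hN l hw)
  refine ⟨R.radical φ, fun i x m hm => R.ρ_mem_radical hN hφ i x hm, fun h => hw0 ?_, fun h => ?_⟩
  · rw [h] at hwQ; exact (Submodule.mem_bot K).mp hwQ
  · have h1 : R.v ∈ R.radical φ := by rw [h]; trivial
    have h2 := h1 []
    simp [hv] at h2

end HighestWeightRep

/-! ### Independence of words in operators close to derivations -/

section Derivations

variable {K S ι : Type*} [Field K] [CommRing S] [Algebra K S]

lemma derivation_mem_pow (D : Derivation K S S) (I : Ideal S) (n : ℕ) {f : S}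
    (hf : f ∈ I ^ (n + 1)) : D f ∈ I ^ n := by
  induction n generalizing f with
  | zero => simp
  | succ n ih =>
    rw [pow_succ] at hf
    induction hf using Submodule.mul_induction_on' with
    | mem_mul_mem a ha b hb =>
      rw [Derivation.leibniz, smul_eq_mul, smul_eq_mul]
      refine add_mem (Ideal.mul_mem_right _ _ ha) ?_
      rw [pow_succ']
      exact Ideal.mul_mem_mul hb (ih ha)
    | add x _ y _ hx hy => rw [map_add]; exact add_mem hx hy

lemma prod_map_mem_pow {I : Ideal S} {ξ : ι → S} (hξ : ∀ i, ξ i ∈ I) (k : Multiset ι) :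
    (k.map ξ).prod ∈ I ^ k.card := by
  induction k using Multiset.induction_on with
  | empty => simp
  | cons i k ih =>
    rw [Multiset.map_cons, Multiset.prod_cons, Multiset.card_cons, pow_succ']
    exact Ideal.mul_mem_mul (hξ i) ih

/-- If `D` is a derivation which at the zero locus of `I` is the derivative with respect to `ξ j`,
then it acts on monomials in the `ξ i` as this derivative, to leading order. -/
lemma derivation_monomial [DecidableEq ι] {I : Ideal S} {ξ : ι → S} (hξ : ∀ i, ξ i ∈ I)
    (D : Derivation K S S) (j : ι) (hD : ∀ i, D (ξ i) - (if i = j then 1 else 0) ∈ I)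
    (k : Multiset ι) :
    D (k.map ξ).prod - k.count j • ((k.erase j).map ξ).prod ∈ I ^ k.card := by
  induction k using Multiset.induction_on with
  | empty => simp
  | cons i k ih =>
    have h1 : ξ i * (D (k.map ξ).prod - k.count j • ((k.erase j).map ξ).prod) ∈
        I ^ (k.card + 1) := by
      rw [pow_succ']; exact Ideal.mul_mem_mul (hξ i) ih
    have h2 : (k.map ξ).prod * (D (ξ i) - (if i = j then 1 else 0)) ∈ I ^ (k.card + 1) := by
      rw [pow_succ]; exact Ideal.mul_mem_mul (prod_map_mem_pow hξ k) (hD i)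
    rw [Multiset.card_cons]
    convert add_mem h1 h2 using 1
    rw [Multiset.map_cons, Multiset.prod_cons, Derivation.leibniz, smul_eq_mul, smul_eq_mul]
    by_cases hij : i = j
    · subst hij
      rw [Multiset.count_cons_self, Multiset.erase_cons_head, if_pos rfl]
      have h3 : k.count i • (k.map ξ).prod = ξ i * k.count i • ((k.erase i).map ξ).prod := by
        by_cases hi : i ∈ k
        · conv_lhs => rw [← Multiset.cons_erase hi]
          rw [Multiset.map_cons, Multiset.prod_cons, Multiset.cons_erase hi, mul_smul_comm]
        · rw [Multiset.count_eq_zero_of_notMem hi]; simp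
      rw [add_smul, h3]
      ring
    · rw [Multiset.count_cons_of_ne (Ne.symm hij), if_neg hij,
        Multiset.erase_cons_tail _ hij, Multiset.map_cons, Multiset.prod_cons]
      simp only [nsmul_eq_mul]
      ring

variable {A : Type*} [Ring A] [Algebra K A]

/-- Elements `z i` acting on a commutative algebra `S` as derivations up to scalars, such that
at a point `ev` the derivations are dual to functions `ξ i`. -/
structure DualAction (z : ι → A) [DecidableEq ι] (S : Type*) [CommRing S] [Algebra K S] where
  /-- The action. -/
  σ : A →ₐ[K] Module.End K S
  /-- The point. -/
  ev : S →ₐ[K] K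
  /-- The functions. -/
  ξ : ι → S
  /-- The derivations. -/
  D : ι → Derivation K S S
  /-- The scalars. -/
  c : ι → K
  σ_apply (i : ι) (f : S) : σ (z i) f = D i f - c i • f
  ev_ξ (i : ι) : ev (ξ i) = 0
  ev_D (i j : ι) : ev (D j (ξ i)) = if i = j then 1 else 0

namespace DualAction

variable [DecidableEq ι] {z : ι → A} (X : DualAction (K := K) z S)

/-- The ideal of functions that vanish at the point. -/
def ideal : Ideal S := RingHom.ker X.ev

lemma mem_ideal {f : S} : f ∈ X.ideal ↔ X.ev f = 0 := RingHom.mem_ker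

lemma σ_mem_pow (i : ι) (n : ℕ) {f : S} (hf : f ∈ X.ideal ^ (n + 1)) :
    X.σ (z i) f ∈ X.ideal ^ n := by
  rw [X.σ_apply]
  refine sub_mem (derivation_mem_pow _ _ n hf) ?_
  rw [Algebra.smul_def]
  exact Ideal.mul_mem_left _ _ (Ideal.pow_le_pow_right n.le_succ hf)

lemma σ_word_mem_pow (l : List ι) (n : ℕ) {f : S} (hf : f ∈ X.ideal ^ (l.length + n)) :
    X.σ (l.map z).prod f ∈ X.ideal ^ n := by
  induction l generalizing n with
  | nil => simpa using hf
  | cons i l ih =>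
    rw [List.map_cons, List.prod_cons, map_mul, Module.End.mul_apply]
    refine X.σ_mem_pow i n (ih (n + 1) ?_)
    rwa [List.length_cons, add_assoc, add_comm 1] at hf

/-- The value at the point of a word of length less than the degree of a monomial. -/
lemma ev_word_of_lt {l : List ι} {k : Multiset ι} (h : l.length < k.card) :
    X.ev (X.σ (l.map z).prod (k.map X.ξ).prod) = 0 := by
  refine X.mem_ideal.mp ?_
  have h1 := X.σ_word_mem_pow l 1 (f := (k.map X.ξ).prod)
    (Ideal.pow_le_pow_right h (prod_map_mem_pow (fun i => X.mem_ideal.mpr (X.ev_ξ i)) k))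
  rwa [pow_one] at h1

/-- Words pair with monomials of the same degree like monomials in the dual variables. -/
lemma ev_word_ne_zero_iff [CharZero K] (l : List ι) (k : Multiset ι) (h : l.length = k.card) :
    X.ev (X.σ (l.map z).prod (k.map X.ξ).prod) ≠ 0 ↔ (l : Multiset ι) = k := by
  induction l using List.reverseRecOn generalizing k with
  | nil =>
    rw [List.length_nil] at h
    rw [Multiset.card_eq_zero.mp h.symm]
    simp
  | append_singleton l j ih =>
    have hξ (i : ι) : X.ξ i ∈ X.ideal := X.mem_ideal.mpr (X.ev_ξ i)
    have hlen : l.length + 1 = k.card := by simpa using h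
    have h1 : X.σ (z j) (k.map X.ξ).prod - k.count j • ((k.erase j).map X.ξ).prod ∈
        X.ideal ^ (l.length + 1) := by
      rw [X.σ_apply, sub_right_comm, hlen]
      refine sub_mem (derivation_monomial hξ _ j (fun i => X.mem_ideal.mpr ?_) k) ?_
      · rw [map_sub, X.ev_D]; split_ifs <;> simp
      · rw [Algebra.smul_def]
        exact Ideal.mul_mem_left _ _ (prod_map_mem_pow hξ k)
    have h2 : X.ev (X.σ ((l ++ [j]).map z).prod (k.map X.ξ).prod) =
        k.count j • X.ev (X.σ (l.map z).prod ((k.erase j).map X.ξ).prod) := by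
      have h3 := X.σ_word_mem_pow l 1 h1
      rw [pow_one, X.mem_ideal, map_sub, map_sub, map_nsmul, map_nsmul, sub_eq_zero] at h3
      rw [← h3]
      simp
    rw [h2, ← Multiset.coe_add, Multiset.coe_singleton, add_comm, Multiset.singleton_add]
    by_cases hj : j ∈ k
    · have h4 : ((k.count j : ℕ) : K) ≠ 0 := by
        exact_mod_cast (Multiset.count_pos.mpr hj).ne'
      rw [nsmul_eq_mul, mul_ne_zero_iff_left h4, ih (k.erase j) (by
        rw [Multiset.card_erase_of_mem hj, ← hlen]; rfl)]
      constructor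
      · intro h5; rw [h5, Multiset.cons_erase hj]
      · intro h5; rw [← h5, Multiset.erase_cons_head]
    · rw [Multiset.count_eq_zero_of_notMem hj, zero_smul]
      refine iff_of_false (by simp) fun h5 => hj ?_
      rw [← h5]; exact Multiset.mem_cons_self _ _

/-- Words with different underlying multisets are linearly independent. -/
theorem linearIndependent_words [CharZero K] (X : DualAction (K := K) z S) {τ : Type*}
    (wd : τ → List ι) (hwd : Function.Injective fun t => (wd t : Multiset ι)) :
    LinearIndependent K fun t => ((wd t).map z).prod := by
  classical
  rw [linearIndependent_iff']
  intro s c hc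
  by_contra! hcon
  obtain ⟨t₀, ht₀, hct₀⟩ := hcon
  obtain ⟨t, ht, hmax⟩ := (s.filter fun t => c t ≠ 0).exists_max_image (fun t => (wd t).length)
    ⟨t₀, by simp [ht₀, hct₀]⟩
  rw [Finset.mem_filter] at ht
  -- a word of maximal length is detected by the corresponding monomial
  have h := congrArg (fun u => X.ev (X.σ u ((wd t : Multiset ι).map X.ξ).prod)) hc
  simp only [map_sum, map_smul, LinearMap.sum_apply, LinearMap.smul_apply, map_zero,
    LinearMap.zero_apply] at h
  rw [Finset.sum_eq_single t] at h
  · refine (mul_ne_zero ht.2 ?_) h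
    exact (X.ev_word_ne_zero_iff (wd t) (wd t) (by simp)).mpr rfl
  · intro t' ht' hne
    by_cases hct : c t' = 0
    · rw [hct, zero_smul]
    rcases lt_or_eq_of_le (hmax t' (Finset.mem_filter.mpr ⟨ht', hct⟩)) with hlt | heq
    · rw [X.ev_word_of_lt (by simpa using hlt), smul_zero]
    · have h1 := (X.ev_word_ne_zero_iff (wd t') (wd t) (by simpa using heq)).not.mpr
        fun h => hne (hwd h)
      rw [not_not.mp h1, smul_zero]
  · intro h1; exact absurd ht.1 h1

end DualAction
end Derivations

/-! ### The enveloping algebra of a Lie algebra with trivial centre -/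

section Enveloping

variable {K G : Type*} [Field K] [LieRing G] [LieAlgebra K G] {κ : Type*} [Fintype κ]
  [DecidableEq κ]

attribute [local instance 100] LieRing.ofAssociativeRing

/-- The derivation of the coordinate ring of the space of matrices given by right multiplication
with a matrix. -/
def matrixDerivation (A : Matrix κ κ K) :
    Derivation K (MvPolynomial (κ × κ) K) (MvPolynomial (κ × κ) K) :=
  MvPolynomial.mkDerivation K fun p => ∑ k, A k p.2 • MvPolynomial.X (p.1, k)

omit [DecidableEq κ] in
lemma matrixDerivation_X (A : Matrix κ κ K) (p : κ × κ) :
    matrixDerivation A (MvPolynomial.X p) = ∑ k, A k p.2 • MvPolynomial.X (p.1, k) :=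
  MvPolynomial.mkDerivation_X _ _ _

/-- The vector fields on the space of matrices given by right multiplication. -/
def matrixVectorField : Matrix κ κ K →ₗ⁅K⁆ Module.End K (MvPolynomial (κ × κ) K) where
  toFun A := (matrixDerivation A : MvPolynomial (κ × κ) K →ₗ[K] MvPolynomial (κ × κ) K)
  map_add' A B := by
    have : matrixDerivation (A + B) = matrixDerivation A + matrixDerivation B := by
      refine MvPolynomial.derivation_ext fun p => ?_
      simp [matrixDerivation_X, add_smul, Finset.sum_add_distrib]
    rw [this]; rfl
  map_smul' c A := by
    have : matrixDerivation (c • A) = c • matrixDerivation A := by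
      refine MvPolynomial.derivation_ext fun p => ?_
      simp [matrixDerivation_X, mul_smul, Finset.smul_sum]
    rw [this]; rfl
  map_lie' {A B} := by
    have : matrixDerivation ⁅A, B⁆ = ⁅matrixDerivation A, matrixDerivation B⁆ := by
      refine MvPolynomial.derivation_ext fun p => ?_
      simp only [matrixDerivation_X, Derivation.commutator_apply, map_sum, Derivation.map_smul,
        Finset.smul_sum, smul_smul, Ring.lie_def, Matrix.sub_apply, Matrix.mul_apply, sub_smul,
        Finset.sum_sub_distrib, Finset.sum_smul]
      congr 1
      · rw [Finset.sum_comm]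
        exact Finset.sum_congr rfl fun _ _ => Finset.sum_congr rfl fun _ _ => by rw [mul_comm]
      · rw [Finset.sum_comm]
        exact Finset.sum_congr rfl fun _ _ => Finset.sum_congr rfl fun _ _ => by rw [mul_comm]
    rw [this]; rfl

/-- The identity matrix as a point of the space of matrices. -/
def evalOne : MvPolynomial (κ × κ) K →ₐ[K] K :=
  MvPolynomial.aeval fun p => (1 : Matrix κ κ K) p.1 p.2

lemma evalOne_matrixDerivation_X (A : Matrix κ κ K) (p : κ × κ) :
    evalOne (matrixDerivation A (MvPolynomial.X p)) = A p.1 p.2 := by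
  simp [matrixDerivation_X, evalOne, Matrix.one_apply]

/-- The adjoint representation in coordinates. -/
def adMatrix (β : Module.Basis κ K G) : G →ₗ⁅K⁆ Matrix κ κ K :=
  (lieEquivMatrix' : Module.End K (κ → K) ≃ₗ⁅K⁆ Matrix κ κ K).toLieHom.comp
    ((LinearEquiv.lieConj β.equivFun).toLieHom.comp (LieAlgebra.ad K G))

lemma adMatrix_injective (β : Module.Basis κ K G) (hG : ∀ x : G, (∀ y : G, ⁅x, y⁆ = 0) → x = 0) :
    Function.Injective (adMatrix β) := by
  have : Function.Injective (LieAlgebra.ad K G) := by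
    rw [injective_iff_map_eq_zero]
    exact fun x hx => hG x fun y => LinearMap.congr_fun hx y
  exact lieEquivMatrix'.injective.comp ((LinearEquiv.lieConj β.equivFun).injective.comp this)

/-- A Lie algebra with trivial centre acts on the coordinate ring of the space of matrices through
its adjoint representation.  As the stabilizer of the identity matrix is trivial, the vector fields
given by a basis are at this point dual to suitable functions. -/
def envelopingDualAction {ι : Type*} [DecidableEq ι] (z : Module.Basis ι K G) (c : ι → K)
    (β : Module.Basis κ K G) (hG : ∀ x : G, (∀ y : G, ⁅x, y⁆ = 0) → x = 0) :
    DualAction (K := K)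
      (fun i => UniversalEnvelopingAlgebra.ι K (z i) -
        algebraMap K (UniversalEnvelopingAlgebra K G) (c i))
      (MvPolynomial (κ × κ) K) :=
  let g : Matrix κ κ K →ₗ[K] G :=
    ((adMatrix β : G →ₗ[K] Matrix κ κ K).exists_leftInverse_of_injective
    (LinearMap.ker_eq_bot.mpr (adMatrix_injective β hG))).choose
  have hg : ∀ x, g (adMatrix β x) = x := LinearMap.congr_fun
    ((adMatrix β : G →ₗ[K] Matrix κ κ K).exists_leftInverse_of_injective
      (LinearMap.ker_eq_bot.mpr (adMatrix_injective β hG))).choose_spec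
  { σ := UniversalEnvelopingAlgebra.lift K (matrixVectorField.comp (adMatrix β))
    ev := evalOne
    ξ := fun i => ∑ p : κ × κ, z.repr (g (Matrix.single p.1 p.2 1)) i •
      (MvPolynomial.X p - MvPolynomial.C ((1 : Matrix κ κ K) p.1 p.2))
    D := fun i => matrixDerivation (adMatrix β (z i))
    c := c
    σ_apply := fun i f => by
      rw [map_sub, UniversalEnvelopingAlgebra.lift_ι_apply, AlgHom.commutes, LinearMap.sub_apply]
      rfl
    ev_ξ := fun i => by simp [evalOne]
    ev_D := fun i j => by
      simp only [map_sum, Derivation.map_smul, map_sub, map_smul, evalOne_matrixDerivation_X]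
      have h1 : ∑ p : κ × κ, (adMatrix β (z j)) p.1 p.2 • Matrix.single p.1 p.2 (1 : K) =
          adMatrix β (z j) := by
        conv_rhs => rw [Matrix.matrix_eq_sum_single (adMatrix β (z j))]
        rw [Fintype.sum_prod_type]
        simp
      have h2 := congrArg (fun A => z.repr (g A) i) h1
      simp only [map_sum, map_smul, hg, Module.Basis.repr_self] at h2
      simp only [Finsupp.coe_finsetSum, Finset.sum_apply, Finsupp.smul_apply] at h2
      simp only [MvPolynomial.derivation_C, sub_zero, map_zero, smul_eq_mul] at h2 ⊢
      rw [Finsupp.single_apply] at h2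
      rw [if_congr eq_comm rfl rfl, ← h2]
      exact Finset.sum_congr rfl fun _ _ => mul_comm _ _ }

end Enveloping

/-! ### Modules induced from characters of subalgebras -/

section InducedCharacter

open LieAlgebra
open scoped Pointwise

attribute [local instance 100] LieRing.ofAssociativeRing

variable {K G : Type*} [Field K] [LieRing G] [LieAlgebra K G]

local notation "𝓤" => UniversalEnvelopingAlgebra K G
local notation "𝜾" => UniversalEnvelopingAlgebra.ι K (L := G)

variable (K G) in
lemma adjoin_range_ι : Algebra.adjoin K (Set.range 𝜾) = ⊤ := by
  let S := Algebra.adjoin K (Set.range 𝜾)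
  let f : G →ₗ⁅K⁆ S :=
    { toFun := fun x => ⟨𝜾 x, Algebra.subset_adjoin ⟨x, rfl⟩⟩
      map_add' := fun x y => Subtype.ext (map_add _ x y)
      map_smul' := fun c x => Subtype.ext (map_smul _ c x)
      map_lie' := fun {x y} => Subtype.ext (LieHom.map_lie _ x y) }
  have h : S.val.comp (UniversalEnvelopingAlgebra.lift K f) = AlgHom.id K 𝓤 := by
    refine UniversalEnvelopingAlgebra.hom_ext _ (LieHom.ext fun x => ?_)
    change ((UniversalEnvelopingAlgebra.lift K f (𝜾 x) : S) : 𝓤) = 𝜾 x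
    rw [UniversalEnvelopingAlgebra.lift_ι_apply]
    rfl
  refine eq_top_iff.mpr fun u _ => ?_
  have hu : ((UniversalEnvelopingAlgebra.lift K f u : S) : 𝓤) = u := DFunLike.congr_fun h u
  rw [← hu]
  exact (UniversalEnvelopingAlgebra.lift K f u).2

/-- A subspace stable under the Lie algebra is stable under the enveloping algebra. -/
lemma smul_mem_of_ι_smul_mem {M : Type*} [AddCommGroup M] [Module K M] [Module 𝓤 M]
    [IsScalarTower K 𝓤 M] (W : Submodule K M) (hW : ∀ x, ∀ m ∈ W, 𝜾 x • m ∈ W) (u : 𝓤) {m : M}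
    (hm : m ∈ W) : u • m ∈ W := by
  have hu : u ∈ Algebra.adjoin K (Set.range 𝜾) := by rw [adjoin_range_ι]; trivial
  induction hu using Algebra.adjoin_induction generalizing m with
  | mem u hu => obtain ⟨x, rfl⟩ := hu; exact hW x m hm
  | algebraMap c => rw [algebraMap_smul]; exact W.smul_mem c hm
  | add u u' _ _ h h' => rw [add_smul]; exact add_mem (h hm) (h' hm)
  | mul u u' _ _ h h' => rw [mul_smul]; exact h (h' hm)

lemma span_words_eq_top {ι : Type*} (z : Module.Basis ι K G) :
    Submodule.span K (Set.range fun l : List ι => (l.map fun i => 𝜾 (z i)).prod) = ⊤ := by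
  set W := Submodule.span K (Set.range fun l : List ι => (l.map fun i => 𝜾 (z i)).prod) with hWdef
  have hW (x : G) (m : 𝓤) (hm : m ∈ W) : 𝜾 x • m ∈ W := by
    have hz (i : ι) : 𝜾 (z i) * m ∈ W := by
      have : W ≤ W.comap (LinearMap.mulLeft K (𝜾 (z i))) := by
        refine Submodule.span_le.mpr ?_
        rintro _ ⟨l, rfl⟩
        exact Submodule.subset_span ⟨i :: l, by simp⟩
      exact this hm
    have hx : x ∈ Submodule.span K (Set.range z) := by rw [z.span_eq]; trivial
    have hle : Submodule.span K (Set.range z) ≤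
        W.comap (LinearMap.mulRight K m ∘ₗ (𝜾 : G →ₗ[K] 𝓤)) := by
      refine Submodule.span_le.mpr ?_
      rintro _ ⟨i, rfl⟩
      exact hz i
    exact hle hx
  refine eq_top_iff.mpr fun u _ => ?_
  have h := smul_mem_of_ι_smul_mem W hW u (Submodule.subset_span ⟨[], by simp⟩ : (1 : 𝓤) ∈ W)
  simpa using h

variable {𝔟 : LieSubalgebra K G} (χ : LieCharacter K 𝔟)

/-- The element `x - χ x` of the enveloping algebra. -/
def shiftedι : 𝔟 →ₗ[K] 𝓤 :=
  (𝜾 : G →ₗ[K] 𝓤) ∘ₗ 𝔟.toSubmodule.subtype - Algebra.linearMap K 𝓤 ∘ₗ (χ : 𝔟 →ₗ[K] K)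

lemma shiftedι_apply (x : 𝔟) : shiftedι χ x = 𝜾 (x : G) - algebraMap K 𝓤 (χ x) := rfl

/-- The left ideal generated by the elements `x - χ x`. -/
def characterIdeal : Submodule 𝓤 𝓤 := Submodule.span 𝓤 (Set.range (shiftedι χ))

lemma shiftedι_mul_sub (x y : 𝔟) :
    shiftedι χ x * shiftedι χ y - shiftedι χ y * shiftedι χ x = shiftedι χ ⁅x, y⁆ := by
  have h1 : 𝜾 (⁅x, y⁆ : 𝔟) = 𝜾 (x : G) * 𝜾 (y : G) - 𝜾 (y : G) * 𝜾 (x : G) := by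
    rw [LieSubalgebra.coe_bracket, LieHom.map_lie, LieRing.of_associative_ring_bracket]
  have h2 : χ ⁅x, y⁆ = 0 := lieCharacter_apply_lie χ x y
  rw [shiftedι_apply, shiftedι_apply, shiftedι_apply, h1, h2, map_zero, sub_zero, sub_mul, mul_sub,
    mul_sub, sub_mul, mul_sub, mul_sub, Algebra.commutes (χ x) (𝜾 (y : G)),
    Algebra.commutes (χ y) (𝜾 (x : G)), Algebra.commutes (χ x) (algebraMap K 𝓤 (χ y))]
  abel

/-- A basis of a Lie algebra which consists of a basis of a subalgebra `𝔟` and a basis of another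
subalgebra. -/
structure SplitBasis (𝔟 : LieSubalgebra K G) (I J : Type*) where
  /-- The basis. -/
  z : Module.Basis (I ⊕ J) K G
  inr_mem (j : J) : z (Sum.inr j) ∈ 𝔟
  mem_span_inr (x : G) (hx : x ∈ 𝔟) : x ∈ Submodule.span K (Set.range fun j => z (Sum.inr j))
  lie_inl (i i' : I) : ⁅z (Sum.inl i), z (Sum.inl i')⁆ ∈
    Submodule.span K (Set.range fun i => z (Sum.inl i))

namespace SplitBasis

variable {I J : Type*} (Z : SplitBasis 𝔟 I J)

/-- The basis elements outside of `𝔟`, in the enveloping algebra. -/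
def y (i : I) : 𝓤 := 𝜾 (Z.z (Sum.inl i))

/-- The basis elements of `𝔟`, shifted by the character, in the enveloping algebra. -/
def b (j : J) : 𝓤 := shiftedι χ ⟨Z.z (Sum.inr j), Z.inr_mem j⟩

lemma shiftedι_mem_span (x : 𝔟) : shiftedι χ x ∈ Submodule.span K (Set.range (Z.b χ)) := by
  obtain ⟨χ', hχ'⟩ := LinearMap.exists_extend (p := 𝔟.toSubmodule) (χ : 𝔟 →ₗ[K] K)
  let F : G →ₗ[K] 𝓤 := (𝜾 : G →ₗ[K] 𝓤) - Algebra.linearMap K 𝓤 ∘ₗ χ'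
  have hF (x : 𝔟) : F x = shiftedι χ x := by
    have : χ' x = χ x := LinearMap.congr_fun hχ' x
    rw [shiftedι_apply, ← this]; rfl
  have h := Submodule.mem_map_of_mem (f := F) (Z.mem_span_inr x x.2)
  rw [Submodule.map_span, ← Set.range_comp, hF] at h
  convert h using 3
  ext j
  exact (hF ⟨Z.z (Sum.inr j), Z.inr_mem j⟩).symm

lemma b_commutator_mem (i j : J) :
    Z.b χ i * Z.b χ j - Z.b χ j * Z.b χ i ∈
      Submodule.span K (Z.b χ '' {_k | (0 : ℕ) = 0 + 0}) := by
  simp only [add_zero, Set.ofPred_true, Set.image_univ]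
  rw [b, b, shiftedι_mul_sub]
  exact Z.shiftedι_mem_span χ _

lemma y_commutator_mem (i j : I) :
    Z.y i * Z.y j - Z.y j * Z.y i ∈ Submodule.span K (Z.y '' {_k | (0 : ℕ) = 0 + 0}) := by
  simp only [add_zero, Set.ofPred_true, Set.image_univ]
  have h := Submodule.mem_map_of_mem (f := (𝜾 : G →ₗ[K] 𝓤)) (Z.lie_inl i j)
  rw [Submodule.map_span, ← Set.range_comp] at h
  rw [y, y, ← LieRing.of_associative_ring_bracket, ← LieHom.map_lie]
  exact h

/-- The product of a word in the `y i`. -/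
def yWord (l : List I) : 𝓤 := (l.map Z.y).prod

/-- The product of a word in the `b j`. -/
def bWord (l : List J) : 𝓤 := (l.map (Z.b χ)).prod

lemma yWord_mem_span (l : List I) : Z.yWord l ∈ Submodule.span K
    {x | ∃ m : Multiset I, (l ≠ [] → m ≠ 0) ∧ x = Z.yWord m.toList} := by
  refine Submodule.span_mono ?_ (prod_mem_span_canonical (ht := fun _ => 0)
    Z.y_commutator_mem Multiset.toList Multiset.coe_toList l)
  rintro _ ⟨m, hm, -, rfl⟩
  exact ⟨m, hm, rfl⟩

lemma bWord_mem_span (l : List J) : Z.bWord χ l ∈ Submodule.span K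
    {x | ∃ m : Multiset J, (l ≠ [] → m ≠ 0) ∧ x = Z.bWord χ m.toList} := by
  refine Submodule.span_mono ?_ (prod_mem_span_canonical (ht := fun _ => 0)
    (Z.b_commutator_mem χ) Multiset.toList Multiset.coe_toList l)
  rintro _ ⟨m, hm, -, rfl⟩
  exact ⟨m, hm, rfl⟩

/-- Words in the unshifted elements of `𝔟` are combinations of words in the shifted ones. -/
lemma unshifted_mem_span (l : List J) : (l.map fun j => 𝜾 (Z.z (Sum.inr j))).prod ∈
    Submodule.span K (Set.range (Z.bWord χ)) := by
  induction l with
  | nil => exact Submodule.subset_span ⟨[], rfl⟩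
  | cons j l ih =>
    rw [List.map_cons, List.prod_cons]
    have h1 : 𝜾 (Z.z (Sum.inr j)) = Z.b χ j + algebraMap K 𝓤 (χ ⟨_, Z.inr_mem j⟩) := by
      rw [b, shiftedι_apply, sub_add_cancel]
    have hle : Submodule.span K (Set.range (Z.bWord χ)) ≤
        (Submodule.span K (Set.range (Z.bWord χ))).comap
          (LinearMap.mulLeft K (𝜾 (Z.z (Sum.inr j)))) := by
      refine Submodule.span_le.mpr ?_
      rintro _ ⟨l', rfl⟩
      change 𝜾 (Z.z (Sum.inr j)) * Z.bWord χ l' ∈ Submodule.span K (Set.range (Z.bWord χ))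
      rw [h1, add_mul, ← Algebra.smul_def]
      exact add_mem (Submodule.subset_span ⟨j :: l', by simp [bWord]⟩)
        (Submodule.smul_mem _ _ (Submodule.subset_span ⟨l', rfl⟩))
    exact hle ih

lemma exists_split (m : Multiset (I ⊕ J)) : ∃ p : List I × List J,
    ((p.1.map Sum.inl ++ p.2.map Sum.inr : List (I ⊕ J)) : Multiset (I ⊕ J)) = m := by
  induction m using Multiset.induction_on with
  | empty => exact ⟨([], []), rfl⟩
  | cons a m ih =>
    obtain ⟨p, rfl⟩ := ih
    cases a with
    | inl i => exact ⟨(i :: p.1, p.2), rfl⟩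
    | inr j =>
      refine ⟨(p.1, j :: p.2), ?_⟩
      rw [List.map_cons, Multiset.cons_coe]
      exact Multiset.coe_eq_coe.mpr List.perm_middle

/-- The enveloping algebra is spanned by the products of words in the `y i` and words in the
`b j`. -/
lemma span_yWord_mul_bWord : Submodule.span K (Set.range Z.yWord) *
    Submodule.span K (Set.range (Z.bWord χ)) = ⊤ := by
  choose can hcan using exists_split (I := I) (J := J)
  rw [eq_top_iff, ← span_words_eq_top Z.z]
  refine Submodule.span_le.mpr ?_
  rintro _ ⟨l, rfl⟩
  have hz (i j : I ⊕ J) : 𝜾 (Z.z i) * 𝜾 (Z.z j) - 𝜾 (Z.z j) * 𝜾 (Z.z i) ∈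
      Submodule.span K ((fun i => 𝜾 (Z.z i)) '' {_k | (0 : ℕ) = 0 + 0}) := by
    simp only [add_zero, Set.ofPred_true, Set.image_univ]
    have h : ⁅Z.z i, Z.z j⁆ ∈ Submodule.span K (Set.range Z.z) := by rw [Z.z.span_eq]; trivial
    have h := Submodule.mem_map_of_mem (f := (𝜾 : G →ₗ[K] 𝓤)) h
    rw [Submodule.map_span, ← Set.range_comp] at h
    rw [← LieRing.of_associative_ring_bracket, ← LieHom.map_lie]
    exact h
  have h := prod_mem_span_canonical (ht := fun _ => 0) hz
    (fun m => (can m).1.map Sum.inl ++ (can m).2.map Sum.inr) hcan l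
  refine Submodule.span_le.mpr ?_ h
  rintro _ ⟨m, -, -, rfl⟩
  rw [List.map_append, List.prod_append, List.map_map, List.map_map]
  exact Submodule.mul_mem_mul (Submodule.subset_span ⟨_, rfl⟩) (Z.unshifted_mem_span χ _)

/-- The left ideal of a character is spanned by the products of words with a nonempty word in the
`b j`. -/
lemma characterIdeal_le : (characterIdeal χ).restrictScalars K ≤ Submodule.span K
    {x | ∃ p : Multiset I × Multiset J, p.2 ≠ 0 ∧
      x = Z.yWord p.1.toList * Z.bWord χ p.2.toList} := by
  set W := Submodule.span K
    {x | ∃ p : Multiset I × Multiset J, p.2 ≠ 0 ∧ x = Z.yWord p.1.toList * Z.bWord χ p.2.toList}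
    with hW
  have hyb (l : List I) (l' : List J) (hl' : l' ≠ []) : Z.yWord l * Z.bWord χ l' ∈ W := by
    have h := Submodule.mul_mem_mul (Z.yWord_mem_span l) (Z.bWord_mem_span χ l')
    rw [Submodule.span_mul_span] at h
    refine Submodule.span_mono ?_ h
    rintro _ ⟨_, ⟨m, -, rfl⟩, _, ⟨m', hm', rfl⟩, rfl⟩
    exact ⟨(m, m'), hm' hl', rfl⟩
  have hb (u : 𝓤) (j : J) : u * Z.b χ j ∈ W := by
    have hu : u ∈ Submodule.span K (Set.range Z.yWord) *
      Submodule.span K (Set.range (Z.bWord χ)) := by rw [span_yWord_mul_bWord]; trivial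
    rw [Submodule.span_mul_span] at hu
    have hle : Submodule.span K (Set.range Z.yWord * Set.range (Z.bWord χ)) ≤
        W.comap (LinearMap.mulRight K (Z.b χ j)) := by
      refine Submodule.span_le.mpr ?_
      rintro _ ⟨_, ⟨l, rfl⟩, _, ⟨l', rfl⟩, rfl⟩
      have := hyb l (l' ++ [j]) (by simp)
      change Z.yWord l * Z.bWord χ l' * Z.b χ j ∈ W
      rw [mul_assoc]
      simpa [bWord] using this
    exact hle hu
  have hb' (u : 𝓤) (x : 𝔟) : u * shiftedι χ x ∈ W := by
    have hle : Submodule.span K (Set.range (Z.b χ)) ≤ W.comap (LinearMap.mulLeft K u) := by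
      refine Submodule.span_le.mpr ?_
      rintro _ ⟨j, rfl⟩
      exact hb u j
    exact hle (Z.shiftedι_mem_span χ x)
  intro x hx
  refine Submodule.closure_induction (p := fun x _ => x ∈ W) ?_ ?_ ?_ hx
  · exact zero_mem _
  · exact fun _ _ _ _ => add_mem
  · rintro u _ ⟨x, rfl⟩
    exact hb' u x

/-- The products of words in the `y i` and words in the `b j`, one for each pair of multisets, are
linearly independent. -/
lemma linearIndependent_yWord_mul_bWord [CharZero K] [FiniteDimensional K G]
    (hG : ∀ x : G, (∀ y : G, ⁅x, y⁆ = 0) → x = 0) :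
    LinearIndependent K fun p : Multiset I × Multiset J =>
      Z.yWord p.1.toList * Z.bWord χ p.2.toList := by
  classical
  let c : I ⊕ J → K := Sum.elim (fun _ => 0) fun j => χ ⟨Z.z (Sum.inr j), Z.inr_mem j⟩
  let wd (p : Multiset I × Multiset J) : List (I ⊕ J) :=
    p.1.toList.map Sum.inl ++ p.2.toList.map Sum.inr
  have hwd : Function.Injective fun p => (wd p : Multiset (I ⊕ J)) := by
    intro p q h
    have hcoe (p : Multiset I × Multiset J) : (wd p : Multiset (I ⊕ J)) =
        p.1.map Sum.inl + p.2.map Sum.inr := by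
      rw [← Multiset.coe_add, ← Multiset.map_coe, ← Multiset.map_coe, Multiset.coe_toList,
        Multiset.coe_toList]
    simp only [hcoe] at h
    refine Prod.ext (Multiset.ext.mpr fun i => ?_) (Multiset.ext.mpr fun j => ?_)
    · have h1 := congrArg (Multiset.count (Sum.inl i)) h
      simpa [Multiset.count_map_eq_count' _ _ Sum.inl_injective,
        Multiset.count_eq_zero_of_notMem] using h1
    · have h1 := congrArg (Multiset.count (Sum.inr j)) h
      simpa [Multiset.count_map_eq_count' _ _ Sum.inr_injective,
        Multiset.count_eq_zero_of_notMem] using h1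
  have h := (envelopingDualAction Z.z c (Module.finBasis K G) hG).linearIndependent_words wd hwd
  have heq (p : Multiset I × Multiset J) : Z.yWord p.1.toList * Z.bWord χ p.2.toList =
      ((wd p).map fun i => 𝜾 (Z.z i) - algebraMap K 𝓤 (c i)).prod := by
    rw [List.map_append, List.prod_append, List.map_map, List.map_map]
    congr 1
    refine congrArg List.prod (List.map_congr_left fun i _ => ?_)
    simp [y, c]
  rw [funext heq]
  exact h

/-- The words in the `y i`, one for each multiset, are linearly independent modulo the left ideal of
a character of `𝔟`. -/
theorem linearIndependent_mk_yWord [CharZero K] [FiniteDimensional K G]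
    (hG : ∀ x : G, (∀ y : G, ⁅x, y⁆ = 0) → x = 0) :
    LinearIndependent K fun m : Multiset I =>
      (characterIdeal χ).mkQ (Z.yWord m.toList) := by
  have h := Z.linearIndependent_yWord_mul_bWord χ hG
  have hy : LinearIndependent K fun m : Multiset I => Z.yWord m.toList := by
    convert h.comp (fun m : Multiset I => (m, (0 : Multiset J)))
      (fun m m' h => (Prod.mk.inj h).1) using 2
    simp [bWord]
  refine hy.map (f := (characterIdeal χ).mkQ.restrictScalars K) ?_
  have hdis := h.disjoint_span_image (s := {p | p.2 = 0}) (t := {p | p.2 ≠ 0})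
    (Set.disjoint_left.mpr fun p h h' => h' h)
  refine hdis.mono (Submodule.span_mono ?_) ?_
  · rintro _ ⟨m, rfl⟩
    exact ⟨(m, 0), rfl, by simp [bWord]⟩
  · intro x hx
    have hx' : x ∈ (characterIdeal χ).restrictScalars K := by
      have : (characterIdeal χ).mkQ x = 0 := hx
      simpa using this
    refine Submodule.span_mono ?_ (Z.characterIdeal_le χ hx')
    rintro _ ⟨p, hp, rfl⟩
    exact ⟨p, hp, rfl⟩

/-- There is a functional on the quotient by the left ideal of a character which is `1` at the class
of `1` and vanishes at the multiples of the `y i`. -/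
theorem exists_functional [CharZero K] [FiniteDimensional K G]
    (hG : ∀ x : G, (∀ y : G, ⁅x, y⁆ = 0) → x = 0) :
    ∃ φ : (𝓤 ⧸ characterIdeal χ) →ₗ[K] K, φ ((characterIdeal χ).mkQ 1) = 1 ∧
      ∀ i m, φ (Z.y i • m) = 0 := by
  let π : 𝓤 →ₗ[K] 𝓤 ⧸ characterIdeal χ := (characterIdeal χ).mkQ.restrictScalars K
  have hind := Z.linearIndependent_mk_yWord χ hG
  let W : Submodule K (𝓤 ⧸ characterIdeal χ) :=
    Submodule.span K ((fun m : Multiset I => π (Z.yWord m.toList)) '' {m | m ≠ 0})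
  have h1 : π 1 ∉ W := by
    have h : π (Z.yWord (0 : Multiset I).toList) ∉ W :=
      hind.notMem_span_image (s := {m | m ≠ 0}) (x := 0) (by simp)
    rwa [show Z.yWord (0 : Multiset I).toList = 1 by simp [yWord]] at h
  obtain ⟨f, hf1, hfW⟩ := Submodule.exists_le_ker_of_notMem h1
  have hW (i : I) (u : 𝓤) : π (Z.y i * u) ∈ W := by
    have hu : u ∈ Submodule.span K (Set.range Z.yWord) *
      Submodule.span K (Set.range (Z.bWord χ)) := by rw [span_yWord_mul_bWord]; trivial
    rw [Submodule.span_mul_span] at hu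
    have hle : Submodule.span K (Set.range Z.yWord * Set.range (Z.bWord χ)) ≤
        W.comap (π ∘ₗ LinearMap.mulLeft K (Z.y i)) := by
      refine Submodule.span_le.mpr ?_
      rintro _ ⟨_, ⟨l, rfl⟩, _, ⟨l', rfl⟩, rfl⟩
      change π (Z.y i * (Z.yWord l * Z.bWord χ l')) ∈ W
      rcases List.eq_nil_or_concat' l' with rfl | ⟨l', j, rfl⟩
      · have h := Submodule.mem_map_of_mem (f := π) (Z.yWord_mem_span (i :: l))
        rw [Submodule.map_span] at h
        have h2 : Z.y i * (Z.yWord l * Z.bWord χ []) = Z.yWord (i :: l) := by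
          simp [yWord, bWord]
        rw [h2]
        refine Submodule.span_mono ?_ h
        rintro _ ⟨_, ⟨m, hm, rfl⟩, rfl⟩
        exact ⟨m, hm (by simp), rfl⟩
      · have h2 : Z.y i * (Z.yWord l * Z.bWord χ (l' ++ [j])) ∈ characterIdeal χ := by
          have h3 : Z.y i * (Z.yWord l * Z.bWord χ (l' ++ [j])) =
              (Z.y i * Z.yWord l * Z.bWord χ l') • Z.b χ j := by
            simp [bWord, mul_assoc]
          rw [h3]
          exact Submodule.smul_mem _ _ (Submodule.subset_span ⟨_, rfl⟩)
        have h4 : π (Z.y i * (Z.yWord l * Z.bWord χ (l' ++ [j]))) = 0 :=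
          (Submodule.Quotient.mk_eq_zero _).mpr h2
        rw [h4]
        exact zero_mem _
    exact hle hu
  refine ⟨(f (π 1))⁻¹ • f, inv_mul_cancel₀ hf1, fun i m => ?_⟩
  obtain ⟨u, rfl⟩ := (characterIdeal χ).mkQ_surjective m
  have : f (π (Z.y i * u)) = 0 := hfW (hW i u)
  rw [LinearMap.smul_apply]
  exact (congrArg _ this).trans (smul_zero _)

end SplitBasis

/-! ### The universal property of the induced module -/

variable (𝔟) in
/-- The homomorphism of enveloping algebras given by the inclusion of a subalgebra. -/
abbrev subalgebraInclusion : UniversalEnvelopingAlgebra K 𝔟 →ₐ[K] 𝓤 :=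
  UniversalEnvelopingAlgebra.lift K ((UniversalEnvelopingAlgebra.ι K).comp 𝔟.incl)

/-- The one-dimensional representation of the enveloping algebra given by a character. -/
abbrev characterAction : UniversalEnvelopingAlgebra K 𝔟 →ₐ[K] Module.End K K :=
  (Algebra.lmul K K).comp (UniversalEnvelopingAlgebra.lift K χ)

lemma subalgebraInclusion_sub_mem (s : UniversalEnvelopingAlgebra K 𝔟) :
    subalgebraInclusion 𝔟 s - algebraMap K 𝓤 (UniversalEnvelopingAlgebra.lift K χ s) ∈
      characterIdeal χ := by
  have hs : s ∈ Algebra.adjoin K (Set.range (UniversalEnvelopingAlgebra.ι K (L := 𝔟))) := by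
    rw [adjoin_range_ι]; trivial
  induction hs using Algebra.adjoin_induction with
  | mem s hs =>
    obtain ⟨x, rfl⟩ := hs
    rw [UniversalEnvelopingAlgebra.lift_ι_apply, UniversalEnvelopingAlgebra.lift_ι_apply]
    exact Submodule.subset_span ⟨x, rfl⟩
  | algebraMap c => rw [AlgHom.commutes, AlgHom.commutes]; simp
  | add s s' _ _ h h' =>
    rw [map_add, map_add, map_add, add_sub_add_comm]
    exact add_mem h h'
  | mul s s' _ _ h h' =>
    have key : subalgebraInclusion 𝔟 (s * s') -
        algebraMap K 𝓤 (UniversalEnvelopingAlgebra.lift K χ (s * s')) =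
        subalgebraInclusion 𝔟 s • (subalgebraInclusion 𝔟 s' -
          algebraMap K 𝓤 (UniversalEnvelopingAlgebra.lift K χ s')) +
        algebraMap K 𝓤 (UniversalEnvelopingAlgebra.lift K χ s') • (subalgebraInclusion 𝔟 s -
          algebraMap K 𝓤 (UniversalEnvelopingAlgebra.lift K χ s)) := by
      rw [map_mul, map_mul, map_mul, smul_eq_mul, smul_eq_mul, mul_sub, mul_sub,
        Algebra.commutes _ (subalgebraInclusion 𝔟 s),
        Algebra.commutes _ (algebraMap K 𝓤 (UniversalEnvelopingAlgebra.lift K χ s))]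
      abel
    rw [key]
    exact add_mem (Submodule.smul_mem _ _ h') (Submodule.smul_mem _ _ h)

/-- The canonical map from the induced module to the quotient by the left ideal of the character. -/
def inducedToQuotient :
    InducedModule (subalgebraInclusion 𝔟) (characterAction χ) →ₗ[𝓤] 𝓤 ⧸ characterIdeal χ :=
  (balancedRelations (subalgebraInclusion 𝔟) (characterAction χ)).liftQ
    ((characterIdeal χ).mkQ ∘ₗ
      (TensorProduct.AlgebraTensorModule.rid K 𝓤 𝓤 : 𝓤 ⊗[K] K →ₗ[𝓤] 𝓤)) (by
    refine Submodule.span_le.mpr ?_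
    rintro _ ⟨r, s, c, rfl⟩
    simp only [SetLike.mem_coe, LinearMap.mem_ker, LinearMap.comp_apply, map_sub]
    rw [← map_sub]
    refine (Submodule.Quotient.mk_eq_zero _).mpr ?_
    simp only [LinearEquiv.coe_coe, TensorProduct.AlgebraTensorModule.rid_tmul]
    have key : c • (r * subalgebraInclusion 𝔟 s) - characterAction χ s c • r =
        (c • r) • (subalgebraInclusion 𝔟 s -
          algebraMap K 𝓤 (UniversalEnvelopingAlgebra.lift K χ s)) := by
      have h1 : characterAction χ s c = UniversalEnvelopingAlgebra.lift K χ s * c := rfl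
      rw [h1, smul_eq_mul, mul_sub, smul_mul_assoc, smul_mul_assoc,
        ← Algebra.commutes _ r, ← Algebra.smul_def, smul_smul, mul_comm c]
    rw [key]
    exact Submodule.smul_mem _ _ (subalgebraInclusion_sub_mem χ s))

/-- The canonical generator of the induced module. -/
def inducedVector : InducedModule (subalgebraInclusion 𝔟) (characterAction χ) :=
  Submodule.Quotient.mk (1 ⊗ₜ[K] 1)

lemma inducedToQuotient_vector :
    inducedToQuotient χ (inducedVector χ) = (characterIdeal χ).mkQ 1 := by
  change (characterIdeal χ).mkQ (TensorProduct.AlgebraTensorModule.rid K 𝓤 𝓤 (1 ⊗ₜ[K] 1)) = _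
  rw [TensorProduct.AlgebraTensorModule.rid_tmul, one_smul]

lemma ι_smul_inducedVector (x : 𝔟) : 𝜾 (x : G) • inducedVector χ = χ x • inducedVector χ := by
  rw [inducedVector, ← Submodule.Quotient.mk_smul, ← Submodule.Quotient.mk_smul,
    Submodule.Quotient.eq]
  refine Submodule.subset_span ⟨1, UniversalEnvelopingAlgebra.ι K x, 1, ?_⟩
  have h1 : characterAction χ (UniversalEnvelopingAlgebra.ι K x) 1 = χ x • (1 : K) := by
    change UniversalEnvelopingAlgebra.lift K χ (UniversalEnvelopingAlgebra.ι K x) * 1 = _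
    rw [UniversalEnvelopingAlgebra.lift_ι_apply]; rfl
  rw [h1, UniversalEnvelopingAlgebra.lift_ι_apply, TensorProduct.tmul_smul,
    TensorProduct.smul_tmul', smul_eq_mul, mul_one, one_mul]
  rfl

lemma inducedModule_cyclic (m : InducedModule (subalgebraInclusion 𝔟) (characterAction χ)) :
    ∃ u : 𝓤, m = u • inducedVector χ := by
  obtain ⟨w, rfl⟩ := Submodule.Quotient.mk_surjective _ m
  refine ⟨TensorProduct.AlgebraTensorModule.rid K 𝓤 𝓤 w, ?_⟩
  rw [inducedVector, ← Submodule.Quotient.mk_smul, TensorProduct.smul_tmul', smul_eq_mul, mul_one]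
  congr 1
  induction w using TensorProduct.induction_on with
  | zero => simp
  | tmul u c =>
    rw [TensorProduct.AlgebraTensorModule.rid_tmul, TensorProduct.smul_tmul, smul_eq_mul, mul_one]
  | add x y hx hy => rw [map_add, TensorProduct.add_tmul, ← hx, ← hy]

end InducedCharacter

/-! ### Root vectors of a split semisimple Lie algebra -/

section RootVectors

open LieAlgebra LieModule LieAlgebra.IsKilling

variable {K L : Type*} [Field K] [CharZero K] [LieRing L] [LieAlgebra K L]
  [FiniteDimensional K L] [IsKilling K L]
  {H : LieSubalgebra K L} [H.IsCartanSubalgebra] [IsTriangularizable K H L]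

omit [CharZero K] in
/-- Opposite root vectors whose pairing under the Killing form is `1`. -/
lemma exists_rootVectors (α : H.root) : ∃ p : L × L, p.1 ∈ rootSpace H (α.1 : H → K) ∧
    p.2 ∈ rootSpace H (-(α.1 : H → K)) ∧ killingForm K L p.1 p.2 = 1 := by
  obtain ⟨e, he, he0⟩ := α.1.exists_ne_zero
  obtain ⟨f, hf, hef⟩ : ∃ f ∈ rootSpace H (-(α.1 : H → K)), killingForm K L e f ≠ 0 := by
    contrapose! he0
    simpa using mem_ker_killingForm_of_mem_rootSpace_of_forall_rootSpace_neg K L H he he0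
  refine ⟨(e, (killingForm K L e f)⁻¹ • f), he, Submodule.smul_mem _ _ hf, ?_⟩
  simp [hef]

/-- The index type of positive roots. -/
abbrev PosRoot (b : (rootSystem H).Base) : Type _ := {α : H.root // b.IsPos α}

variable {b : (rootSystem H).Base}

/-- A root vector for a positive root. -/
def posVector (a : PosRoot b) : L := (exists_rootVectors a.1).choose.1

/-- A root vector for the negative of a positive root. -/
def negVector (a : PosRoot b) : L := (exists_rootVectors a.1).choose.2

lemma posVector_mem (a : PosRoot b) : posVector a ∈ rootSpace H (a.1.1 : H → K) :=
  (exists_rootVectors a.1).choose_spec.1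

lemma negVector_mem (a : PosRoot b) : negVector a ∈ rootSpace H (-(a.1.1 : H → K)) :=
  (exists_rootVectors a.1).choose_spec.2.1

lemma killingForm_posVector_negVector (a : PosRoot b) :
    killingForm K L (posVector a) (negVector a) = 1 :=
  (exists_rootVectors a.1).choose_spec.2.2

lemma posVector_ne_zero (a : PosRoot b) : posVector a ≠ 0 := fun h => by
  have := killingForm_posVector_negVector a
  rw [h] at this; simp at this

lemma negVector_ne_zero (a : PosRoot b) : negVector a ≠ 0 := fun h => by
  have := killingForm_posVector_negVector a
  rw [h] at this; simp at this

lemma lie_posVector_negVector (a : PosRoot b) :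
    ⁅posVector a, negVector a⁆ = ((cartanEquivDual H).symm a.1.1.toLinear : L) := by
  rw [lie_eq_killingForm_smul_of_mem_rootSpace_of_mem_rootSpace_neg (posVector_mem a)
    (negVector_mem a), killingForm_posVector_negVector, one_smul]

lemma lie_posVector_negVector_mem (a : PosRoot b) :
    ⁅posVector a, negVector a⁆ ∈ H.toSubmodule := by
  rw [lie_posVector_negVector]
  exact SetLike.coe_mem ((cartanEquivDual H).symm a.1.1.toLinear)

lemma mem_span_of_mem_rootSpace {χ : H → K} (γ : H.root) (hγ : (γ.1 : H → K) = χ)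
    {x y : L} (hx : x ∈ rootSpace H χ) (hy : y ∈ rootSpace H χ) (hy0 : y ≠ 0) : x ∈ K ∙ y := by
  subst hγ
  have h1 : Module.finrank K (rootSpace H (γ.1 : H → K)) = 1 :=
    finrank_rootSpace_eq_one γ.1 (H.isNonZero_coe_root γ)
  obtain ⟨c, hc⟩ := exists_smul_eq_of_finrank_eq_one h1
    (x := (⟨y, hy⟩ : rootSpace H (γ.1 : H → K))) (fun h => hy0 (congrArg Subtype.val h)) ⟨x, hx⟩
  exact Submodule.mem_span_singleton.mpr ⟨c, congrArg Subtype.val hc⟩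

variable (b) in
/-- The height of roots extends to a linear functional. -/
lemma exists_heightFunctional : ∃ ℓ : Module.Dual K H →ₗ[K] K,
    ∀ α : H.root, ℓ α.1.toLinear = (b.height α : K) := by
  refine ⟨b.toWeightBasis.constr K fun _ => (1 : K), fun α => ?_⟩
  obtain ⟨f, -, hf⟩ := b.exists_root_eq_sum_int α
  have h1 : (rootSystem H).root α = α.1.toLinear := rfl
  rw [b.height_eq_sum hf.2, ← h1, hf.2, map_sum]
  push_cast
  refine Finset.sum_congr rfl fun j hj => ?_
  have h2 : (rootSystem H).root j = b.toWeightBasis ⟨j, hj⟩ := by simp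
  rw [map_zsmul, h2, Module.Basis.constr_basis]
  simp

variable (b) in
/-- The linear extension of the height of roots. -/
def heightFunctional : Module.Dual K H →ₗ[K] K := (exists_heightFunctional b).choose

lemma heightFunctional_apply (α : H.root) :
    heightFunctional b α.1.toLinear = (b.height α : K) :=
  (exists_heightFunctional b).choose_spec α

/-- The height of a positive root, as a natural number. -/
def posHeight (a : PosRoot b) : ℕ := (b.height a.1).toNat

lemma coe_posHeight (a : PosRoot b) : (posHeight a : ℤ) = b.height a.1 :=
  Int.toNat_of_nonneg (le_of_lt a.2)

lemma heightFunctional_posRoot (a : PosRoot b) :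
    heightFunctional b a.1.1.toLinear = ((posHeight a : ℤ) : K) := by
  rw [heightFunctional_apply, coe_posHeight]

omit [IsKilling K L] [IsTriangularizable K H L] in
lemma exists_root_of_mem {χ : Module.Dual K H} (hχ : χ ≠ 0) {x : L} (hx : x ∈ rootSpace H χ)
    (hx0 : x ≠ 0) : ∃ γ : H.root, γ.1.toLinear = χ := by
  have hbot : rootSpace H χ ≠ ⊥ := fun h => hx0 (by rw [h] at hx; simpa using hx)
  let γ : Weight K H L := ⟨χ, hbot⟩
  have hγ : γ.IsNonZero := fun h => hχ (DFunLike.coe_injective h)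
  exact ⟨⟨γ, by simpa [LieSubalgebra.root] using hγ⟩, rfl⟩

lemma mem_span_posVector {χ : Module.Dual K H} {n : ℕ} (hn : 0 < n)
    (hχ : heightFunctional b χ = ((n : ℤ) : K)) {x : L} (hx : x ∈ rootSpace H χ) :
    x ∈ Submodule.span K (posVector '' {c : PosRoot b | posHeight c = n}) := by
  by_cases hx0 : x = 0
  · rw [hx0]; exact zero_mem _
  have hχ0 : χ ≠ 0 := by
    rintro rfl
    rw [map_zero] at hχ
    have : (n : ℤ) = 0 := by exact_mod_cast hχ.symm
    omega
  obtain ⟨γ, rfl⟩ := exists_root_of_mem hχ0 hx hx0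
  rw [heightFunctional_apply, Int.cast_inj] at hχ
  have hpos : b.IsPos γ := by rw [RootPairing.Base.isPos_iff, hχ]; omega
  refine Submodule.span_mono ?_ (mem_span_of_mem_rootSpace γ rfl hx
    (posVector_mem ⟨γ, hpos⟩) (posVector_ne_zero _))
  rw [Set.singleton_subset_iff]
  refine ⟨⟨γ, hpos⟩, ?_, rfl⟩
  have := coe_posHeight (⟨γ, hpos⟩ : PosRoot b)
  rw [hχ] at this
  exact_mod_cast this

lemma exists_neg_root (γ : H.root) : ∃ γ' : H.root, γ'.1.toLinear = -γ.1.toLinear := by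
  refine ⟨(rootSystem H).reflectionPerm γ γ, ?_⟩
  have h := (rootSystem H).root_reflectionPerm γ γ
  rw [RootPairing.reflection_apply_self] at h
  exact h

lemma mem_span_negVector {χ : Module.Dual K H} {n : ℕ} (hn : 0 < n)
    (hχ : heightFunctional b χ = -((n : ℤ) : K)) {x : L} (hx : x ∈ rootSpace H χ) :
    x ∈ Submodule.span K (negVector '' {c : PosRoot b | posHeight c = n}) := by
  by_cases hx0 : x = 0
  · rw [hx0]; exact zero_mem _
  have hχ0 : χ ≠ 0 := by
    rintro rfl
    rw [map_zero, zero_eq_neg] at hχ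
    have : (n : ℤ) = 0 := by exact_mod_cast hχ
    omega
  obtain ⟨γ, rfl⟩ := exists_root_of_mem hχ0 hx hx0
  obtain ⟨γ', hγ'⟩ := exists_neg_root γ
  have hh : b.height γ' = n := by
    have := heightFunctional_apply (b := b) γ'
    rw [hγ', map_neg, hχ, neg_neg] at this
    exact_mod_cast this.symm
  have hpos : b.IsPos γ' := by rw [RootPairing.Base.isPos_iff, hh]; omega
  have hfun : (γ.1 : H → K) = -(γ'.1 : H → K) := by
    have : γ.1.toLinear = -γ'.1.toLinear := by rw [hγ', neg_neg]
    exact congrArg DFunLike.coe this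
  have hneg := negVector_mem (⟨γ', hpos⟩ : PosRoot b)
  refine Submodule.span_mono ?_ (mem_span_of_mem_rootSpace γ rfl hx
    (by convert hneg using 2) (negVector_ne_zero ⟨γ', hpos⟩))
  rw [Set.singleton_subset_iff]
  refine ⟨⟨γ', hpos⟩, ?_, rfl⟩
  have := coe_posHeight (⟨γ', hpos⟩ : PosRoot b)
  rw [hh] at this
  exact_mod_cast this

lemma eq_zero_of_mem_rootSpace {χ : Module.Dual K H} (hχ0 : χ ≠ 0)
    (hχ : heightFunctional b χ = 0) {x : L} (hx : x ∈ rootSpace H χ) : x = 0 := by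
  by_contra hx0
  obtain ⟨γ, rfl⟩ := exists_root_of_mem hχ0 hx hx0
  rw [heightFunctional_apply] at hχ
  exact b.height_ne_zero γ (by exact_mod_cast hχ)

lemma posVector_mem' (a : PosRoot b) : posVector a ∈ rootSpace H a.1.1.toLinear :=
  posVector_mem a

lemma negVector_mem' (a : PosRoot b) :
    negVector a ∈ rootSpace H ((-a.1.1.toLinear : Module.Dual K H) : H → K) :=
  negVector_mem a

omit [CharZero K] [FiniteDimensional K L] [IsKilling K L] [IsTriangularizable K H L] in
lemma lie_mem_rootSpace {χ ψ : Module.Dual K H} {x y : L} (hx : x ∈ rootSpace H χ)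
    (hy : y ∈ rootSpace H ψ) : ⁅x, y⁆ ∈ rootSpace H ((χ + ψ : Module.Dual K H) : H → K) :=
  lie_mem_genWeightSpace_of_mem_genWeightSpace hx hy

lemma posHeight_pos (a : PosRoot b) : 0 < posHeight a := by
  have h1 := coe_posHeight a
  have h2 : 0 < b.height a.1 := a.2
  omega

lemma lie_posVector_posVector_mem (a c : PosRoot b) : ⁅posVector a, posVector c⁆ ∈
    Submodule.span K (posVector '' {d : PosRoot b | posHeight d = posHeight a + posHeight c}) := by
  refine mem_span_posVector (by have := posHeight_pos a; omega) ?_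
    (lie_mem_rootSpace (posVector_mem' a) (posVector_mem' c))
  rw [map_add, heightFunctional_posRoot, heightFunctional_posRoot]
  push_cast; ring

lemma lie_negVector_negVector_mem (a c : PosRoot b) : ⁅negVector a, negVector c⁆ ∈
    Submodule.span K (negVector '' {d : PosRoot b | posHeight d = posHeight a + posHeight c}) := by
  refine mem_span_negVector (by have := posHeight_pos a; omega) ?_
    (lie_mem_rootSpace (negVector_mem' a) (negVector_mem' c))
  rw [map_add, map_neg, map_neg, heightFunctional_posRoot, heightFunctional_posRoot]
  push_cast; ring

lemma lie_posVector_negVector_mem_of_lt (a c : PosRoot b) (h : posHeight a < posHeight c) :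
    ⁅posVector a, negVector c⁆ ∈
    Submodule.span K (negVector '' {d : PosRoot b | posHeight d + posHeight a = posHeight c}) := by
  have h1 := mem_span_negVector (b := b) (n := posHeight c - posHeight a) (by omega) (by
    rw [map_add, map_neg, heightFunctional_posRoot, heightFunctional_posRoot, Nat.cast_sub h.le]
    push_cast; ring) (lie_mem_rootSpace (posVector_mem' a) (negVector_mem' c))
  refine Submodule.span_mono (Set.image_mono fun d hd => ?_) h1
  have hd : posHeight d = posHeight c - posHeight a := hd
  change posHeight d + posHeight a = posHeight c
  omega

lemma lie_posVector_negVector_mem_of_gt (a c : PosRoot b) (h : posHeight c < posHeight a) :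
    ⁅posVector a, negVector c⁆ ∈
    Submodule.span K (posVector '' {d : PosRoot b | posHeight d + posHeight c = posHeight a}) := by
  have h1 := mem_span_posVector (b := b) (n := posHeight a - posHeight c) (by omega) (by
    rw [map_add, map_neg, heightFunctional_posRoot, heightFunctional_posRoot, Nat.cast_sub h.le]
    push_cast; ring) (lie_mem_rootSpace (posVector_mem' a) (negVector_mem' c))
  refine Submodule.span_mono (Set.image_mono fun d hd => ?_) h1
  have hd : posHeight d = posHeight a - posHeight c := hd
  change posHeight d + posHeight c = posHeight a
  omega

lemma lie_posVector_negVector_of_eq (a c : PosRoot b) (h : posHeight a = posHeight c)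
    (hac : a ≠ c) : ⁅posVector a, negVector c⁆ = 0 := by
  refine eq_zero_of_mem_rootSpace (b := b) (fun h0 => hac ?_) ?_
    (lie_mem_rootSpace (posVector_mem' a) (negVector_mem' c))
  · rw [← sub_eq_add_neg, sub_eq_zero] at h0
    exact Subtype.ext ((rootSystem H).root.injective h0)
  · rw [map_add, map_neg, heightFunctional_posRoot, heightFunctional_posRoot, h, add_neg_cancel]

variable (b) in
lemma span_rootVectors_eq_top :
    Submodule.span K (Set.range (negVector : PosRoot b → L)) ⊔ H.toSubmodule ⊔
      Submodule.span K (Set.range (posVector : PosRoot b → L)) = ⊤ := by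
  rw [eq_top_iff, ← (isCompl_cartan_rootPart H).sup_eq_top]
  refine sup_le (le_sup_of_le_left le_sup_right) (iSup_le fun γ x hx => ?_)
  have hγ := heightFunctional_apply (b := b) γ
  rcases lt_trichotomy (b.height γ) 0 with h | h | h
  · have h1 := mem_span_negVector (b := b) (χ := γ.1.toLinear) (n := (-b.height γ).toNat)
      (by omega) (by rw [hγ, Int.toNat_of_nonneg (by omega)]; push_cast; ring) hx
    exact Submodule.mem_sup_left (Submodule.mem_sup_left
      (Submodule.span_mono (Set.image_subset_range _ _) h1))
  · exact absurd h (b.height_ne_zero γ)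
  · have h1 := mem_span_posVector (b := b) (χ := γ.1.toLinear) (n := (b.height γ).toNat)
      (by omega) (by rw [hγ, Int.toNat_of_nonneg (by omega)]) hx
    exact Submodule.mem_sup_right (Submodule.span_mono (Set.image_subset_range _ _) h1)

lemma lie_cartan_negVector (h : L) (hh : h ∈ H.toSubmodule) (a : PosRoot b) :
    ∃ c : K, ⁅h, negVector a⁆ = c • negVector a :=
  ⟨-a.1.1 ⟨h, hh⟩, lie_eq_smul_of_mem_rootSpace (negVector_mem a) ⟨h, hh⟩⟩

variable (b) in
/-- The root vectors of a split semisimple Lie algebra, sorted by height. -/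
def rootVectors : TriangularVectors K L (PosRoot b) where
  H := H.toSubmodule
  ht := posHeight
  e := posVector
  f := negVector
  ht_pos := posHeight_pos
  lie_cartan_f := lie_cartan_negVector
  lie_e_e := lie_posVector_posVector_mem
  lie_f_f := lie_negVector_negVector_mem
  lie_e_f_of_lt := lie_posVector_negVector_mem_of_lt
  lie_e_f_of_gt := lie_posVector_negVector_mem_of_gt
  lie_e_f_of_eq := lie_posVector_negVector_of_eq
  lie_e_f_self := lie_posVector_negVector_mem
  span_eq_top := span_rootVectors_eq_top b

lemma linearIndependent_rootVectors :
    LinearIndependent K (Sum.elim negVector posVector : PosRoot b ⊕ PosRoot b → L) := by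
  have hind := LieModule.iSupIndep_genWeightSpace K H L
  rw [← LieSubmodule.iSupIndep_toSubmodule] at hind
  let χ : PosRoot b ⊕ PosRoot b → Module.Dual K H :=
    Sum.elim (fun a => -a.1.1.toLinear) fun a => a.1.1.toLinear
  have hroot : Function.Injective fun a : PosRoot b => a.1.1.toLinear := fun a c h =>
    Subtype.ext ((rootSystem H).root.injective h)
  have hne (a c : PosRoot b) : -a.1.1.toLinear ≠ c.1.1.toLinear := fun h => by
    have h1 := congrArg (heightFunctional b) h
    rw [map_neg, heightFunctional_posRoot, heightFunctional_posRoot] at h1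
    have h2 : -(posHeight a : ℤ) = posHeight c := by exact_mod_cast h1
    have := posHeight_pos a
    omega
  have hχ : Function.Injective fun s => (χ s : H → K) := by
    refine DFunLike.coe_injective.comp (Function.Injective.sumElim ?_ hroot hne)
    exact fun a c h => hroot (neg_injective h)
  refine (hind.comp hχ).linearIndependent _ (fun s => ?_) fun s => ?_
  · cases s with
    | inl a => exact negVector_mem a
    | inr a => exact posVector_mem a
  · cases s with
    | inl a => exact negVector_ne_zero a
    | inr a => exact posVector_ne_zero a

lemma span_range_rootVectors_le :
    Submodule.span K (Set.range (Sum.elim negVector posVector : PosRoot b ⊕ PosRoot b → L)) ≤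
      rootPart H := by
  refine Submodule.span_le.mpr ?_
  rintro _ ⟨a | a, rfl⟩
  · obtain ⟨γ', hγ'⟩ := exists_neg_root a.1
    have h : (-(a.1.1 : H → K)) = (γ'.1 : H → K) := (congrArg DFunLike.coe hγ').symm
    have h2 := negVector_mem a
    rw [h] at h2
    exact Submodule.mem_iSup_of_mem γ' h2
  · exact Submodule.mem_iSup_of_mem a.1 (posVector_mem a)

variable (b) in
/-- The basis given by the negative root vectors, a basis of the Cartan subalgebra, and the positive
root vectors. -/
def triangularBasis :
    Module.Basis (PosRoot b ⊕ (Fin (Module.finrank K H) ⊕ PosRoot b)) K L :=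
  let h : Fin (Module.finrank K H) → L := fun j => Module.finBasis K H j
  have hh : Submodule.span K (Set.range h) = H.toSubmodule := by
    have h1 : Set.range h = H.toSubmodule.subtype '' Set.range (Module.finBasis K H) := by
      rw [← Set.range_comp]; rfl
    rw [h1, ← Submodule.map_span, (Module.finBasis K H).span_eq, Submodule.map_top,
      Submodule.range_subtype]
  have hli : LinearIndependent K
      (Sum.elim h (Sum.elim negVector posVector : PosRoot b ⊕ PosRoot b → L)) := by
    refine LinearIndependent.sum_type ?_ linearIndependent_rootVectors ?_
    · exact (Module.finBasis K H).linearIndependent.map' H.toSubmodule.subtype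
        (Submodule.ker_subtype _)
    · rw [hh]
      exact (isCompl_cartan_rootPart H).disjoint.mono_right span_range_rootVectors_le
  have hsp : ⊤ ≤ Submodule.span K (Set.range
      (Sum.elim h (Sum.elim negVector posVector : PosRoot b ⊕ PosRoot b → L))) := by
    rw [Set.Sum.elim_range, Set.Sum.elim_range, Submodule.span_union, Submodule.span_union, hh,
      ← span_rootVectors_eq_top b]
    refine sup_le (sup_le ?_ ?_) ?_
    · exact le_sup_of_le_right le_sup_left
    · exact le_sup_left
    · exact le_sup_of_le_right le_sup_right
  (Module.Basis.mk hli hsp).reindex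
    ((Equiv.sumAssoc _ _ _).symm.trans
      (((Equiv.sumComm _ _).sumCongr (Equiv.refl _)).trans (Equiv.sumAssoc _ _ _)))

lemma triangularBasis_inl (a : PosRoot b) : triangularBasis b (Sum.inl a) = negVector a := by
  simp [triangularBasis]

lemma triangularBasis_inr_inl (j : Fin (Module.finrank K H)) :
    triangularBasis b (Sum.inr (Sum.inl j)) = (Module.finBasis K H j : L) := by
  simp [triangularBasis]

lemma triangularBasis_inr_inr (a : PosRoot b) :
    triangularBasis b (Sum.inr (Sum.inr a)) = posVector a := by
  simp [triangularBasis]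

end RootVectors

/-! ### Bases of the truncated current Lie algebra -/

section CurrentBasis

variable (K : Type*) [Field K] (N : ℕ)

/-- The basis of the truncated polynomial algebra given by the powers of `t`. -/
def tBasis : Module.Basis (Fin (N + 1)) K (TruncPoly K N) :=
  (AdjoinRoot.powerBasis' (Polynomial.monic_X_pow (R := K) (N + 1))).basis.reindex
    (finCongr (by simp))

lemma tBasis_apply (i : Fin (N + 1)) : tBasis K N i = tPow K N i := by
  rw [tBasis, Module.Basis.reindex_apply, PowerBasis.coe_basis, AdjoinRoot.powerBasis'_gen, tPow,
    map_pow, AdjoinRoot.mk_X]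
  rfl

lemma tPow_mul (i j : ℕ) : tPow K N i * tPow K N j = tPow K N (i + j) := by
  simp [tPow, pow_add]

lemma tPow_eq_zero {i : ℕ} (hi : N < i) : tPow K N i = 0 := by
  rw [tPow, AdjoinRoot.mk_eq_zero]
  exact pow_dvd_pow _ hi

variable {K} {L : Type*} [LieRing L] [LieAlgebra K L]

lemma tmul_lie_tmul (i j : ℕ) (x y : L) :
    ⁅tPow K N i ⊗ₜ[K] x, tPow K N j ⊗ₜ[K] y⁆ = tPow K N (i + j) ⊗ₜ[K] ⁅x, y⁆ := by
  rw [LieAlgebra.ExtendScalars.bracket_tmul, tPow_mul]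

lemma tmul_mem_span {X : Type*} (u : X → L) (a : TruncPoly K N) {x : L}
    (hx : x ∈ Submodule.span K (Set.range u)) :
    a ⊗ₜ[K] x ∈ Submodule.span K
      (Set.range fun p : Fin (N + 1) × X => tPow K N p.1 ⊗ₜ[K] u p.2) := by
  have ha : a ∈ Submodule.span K (Set.range (tBasis K N)) := by
    rw [(tBasis K N).span_eq]; trivial
  induction ha using Submodule.span_induction with
  | mem a ha =>
    obtain ⟨i, rfl⟩ := ha
    induction hx using Submodule.span_induction with
    | mem x hx =>
      obtain ⟨k, rfl⟩ := hx
      exact Submodule.subset_span ⟨(i, k), by simp [tBasis_apply]⟩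
    | zero => simp
    | add x y _ _ hx hy => rw [TensorProduct.tmul_add]; exact add_mem hx hy
    | smul c x _ hx => rw [TensorProduct.tmul_smul]; exact Submodule.smul_mem _ _ hx
  | zero => simp
  | add x y _ _ hx hy => rw [TensorProduct.add_tmul]; exact add_mem hx hy
  | smul c x _ hx => rw [← TensorProduct.smul_tmul']; exact Submodule.smul_mem _ _ hx

lemma span_tPow_tmul :
    Submodule.span K {z : CurrentAlgebra K L N | ∃ (i : ℕ) (x : L), z = tPow K N i ⊗ₜ[K] x} =
      ⊤ := by
  rw [eq_top_iff]
  rintro z -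
  induction z using TensorProduct.induction_on with
  | zero => exact zero_mem _
  | tmul a x =>
    refine Submodule.span_mono ?_ (tmul_mem_span N (fun x : L => x) a
      (Submodule.subset_span ⟨x, rfl⟩))
    rintro _ ⟨p, rfl⟩
    exact ⟨p.1, p.2, rfl⟩
  | add x y hx hy => exact add_mem hx hy

/-- If `L` has trivial centre, then so has its truncated current Lie algebra. -/
lemma currentAlgebra_centre (hL : ∀ x : L, (∀ y : L, ⁅x, y⁆ = 0) → x = 0)
    (x : CurrentAlgebra K L N) (hx : ∀ y : CurrentAlgebra K L N, ⁅x, y⁆ = 0) : x = 0 := by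
  let eqv := TensorProduct.equivFinsuppOfBasisLeft (N := L) (tBasis K N)
  have key (x : CurrentAlgebra K L N) (y : L) (i : Fin (N + 1)) :
      eqv ⁅x, (1 : TruncPoly K N) ⊗ₜ[K] y⁆ i = ⁅eqv x i, y⁆ := by
    induction x using TensorProduct.induction_on with
    | zero => simp
    | tmul a z =>
      rw [LieAlgebra.ExtendScalars.bracket_tmul, mul_one]
      simp [eqv]
    | add x z hx hz => rw [add_lie, map_add, map_add, Finsupp.add_apply, hx, hz,
        Finsupp.add_apply, add_lie]
  refine eqv.injective ?_
  ext i
  rw [map_zero, Finsupp.zero_apply]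
  refine hL _ fun y => ?_
  rw [← key, hx, map_zero, Finsupp.zero_apply]

end CurrentBasis

section Verma

open LieAlgebra LieModule LieAlgebra.IsKilling

variable {K L : Type*} [Field K] [CharZero K] [LieRing L] [LieAlgebra K L]
  [FiniteDimensional K L] [IsKilling K L]
  {H : LieSubalgebra K L} [H.IsCartanSubalgebra] [IsTriangularizable K H L]

lemma eq_zero_of_forall_lie_eq_zero (K : Type*) {L : Type*} [Field K] [LieRing L]
    [LieAlgebra K L] [IsKilling K L] (x : L) (hx : ∀ y : L, ⁅x, y⁆ = 0) : x = 0 := by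
  have had : ad K L x = 0 := by
    ext y
    exact hx y
  have h : x ∈ LinearMap.ker (killingForm K L) := by
    rw [LinearMap.mem_ker]
    ext y
    rw [killingForm_apply_apply, had, LinearMap.zero_comp, map_zero, LinearMap.zero_apply]
  rwa [IsKilling.ker_killingForm_eq_bot, Submodule.mem_bot] at h

/-- The basis of the truncated current Lie algebra that consists of products of powers of `t` with
negative root vectors, elements of a basis of the Cartan subalgebra, and positive root vectors. -/
def currentBasis (b : (rootSystem H).Base) (N : ℕ) :
    Module.Basis ((Fin (N + 1) × PosRoot b) ⊕
      (Fin (N + 1) × (Fin (Module.finrank K H) ⊕ PosRoot b))) K (CurrentAlgebra K L N) :=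
  ((tBasis K N).tensorProduct (triangularBasis b)).reindex (Equiv.prodSumDistrib _ _ _)

lemma currentBasis_inl (b : (rootSystem H).Base) (N : ℕ) (p : Fin (N + 1) × PosRoot b) :
    currentBasis b N (Sum.inl p) = tPow K N p.1 ⊗ₜ[K] negVector p.2 := by
  simp [currentBasis, tBasis_apply, triangularBasis_inl]

lemma currentBasis_inr (b : (rootSystem H).Base) (N : ℕ)
    (p : Fin (N + 1) × (Fin (Module.finrank K H) ⊕ PosRoot b)) :
    currentBasis b N (Sum.inr p) = tPow K N p.1 ⊗ₜ[K] triangularBasis b (Sum.inr p.2) := by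
  simp [currentBasis, tBasis_apply]

lemma currentBasis_inr_mem (b : (rootSystem H).Base) (N : ℕ)
    (p : Fin (N + 1) × (Fin (Module.finrank K H) ⊕ PosRoot b)) :
    currentBasis b N (Sum.inr p) ∈ borelHat b N := by
  obtain ⟨i, j | a⟩ := p
  · rw [currentBasis_inr, triangularBasis_inr_inl]
    exact (le_sup_left : cartanHat H N ≤ _)
      (tmul_mem_currentSubspace N _ (SetLike.coe_mem (Module.finBasis K H j)))
  · rw [currentBasis_inr, triangularBasis_inr_inr]
    exact (le_sup_right : positiveHat b N ≤ _) (tmul_mem_currentSubspace N _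
      (Submodule.mem_iSup_of_mem a (posVector_mem a)))

lemma cartan_le_span_triangularBasis (b : (rootSystem H).Base) : H.toSubmodule ≤
    Submodule.span K (Set.range fun k => triangularBasis b (Sum.inr k)) := by
  intro h hh
  have h1 : (⟨h, hh⟩ : H) ∈ Submodule.span K (Set.range (Module.finBasis K H)) := by
    rw [(Module.finBasis K H).span_eq]; trivial
  have h2 : h ∈ (Submodule.span K (Set.range (Module.finBasis K H))).map H.toSubmodule.subtype :=
    ⟨⟨h, hh⟩, h1, rfl⟩
  rw [Submodule.map_span] at h2
  refine Submodule.span_mono ?_ h2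
  rintro _ ⟨_, ⟨j, rfl⟩, rfl⟩
  exact ⟨Sum.inl j, triangularBasis_inr_inl j⟩

lemma positivePart_le_span_triangularBasis (b : (rootSystem H).Base) : positivePart b ≤
    Submodule.span K (Set.range fun k => triangularBasis b (Sum.inr k)) := by
  refine iSup_le fun a x hx => ?_
  refine Submodule.span_mono ?_ (mem_span_of_mem_rootSpace a.1 rfl hx (posVector_mem a)
    (posVector_ne_zero a))
  rw [Set.singleton_subset_iff]
  exact ⟨Sum.inr a, triangularBasis_inr_inr a⟩

lemma mem_span_currentBasis_inr (b : (rootSystem H).Base) (N : ℕ) (x : CurrentAlgebra K L N)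
    (hx : x ∈ borelHat b N) :
    x ∈ Submodule.span K (Set.range fun p => currentBasis b N (Sum.inr p)) := by
  simp only [currentBasis_inr]
  set W := Submodule.span K (Set.range
    fun p : Fin (N + 1) × (Fin (Module.finrank K H) ⊕ PosRoot b) =>
      tPow K N p.1 ⊗ₜ[K] triangularBasis b (Sum.inr p.2)) with hW
  have key {V : Submodule K L} (hV : V ≤ Submodule.span K
      (Set.range fun k => triangularBasis b (Sum.inr k))) : currentSubspace N V ≤ W := fun z hz =>
    currentSubspace_induction N (P := fun z => z ∈ W)
      (fun a x hx => tmul_mem_span N (fun k => triangularBasis b (Sum.inr k)) a (hV hx))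
      W.zero_mem (fun _ _ h h' => W.add_mem h h') hz
  have hle : cartanHat H N ⊔ positiveHat b N ≤ W :=
    sup_le (key (cartan_le_span_triangularBasis b)) (key (positivePart_le_span_triangularBasis b))
  exact hle hx

lemma lie_currentBasis_inl_mem (b : (rootSystem H).Base) (N : ℕ) (p q : Fin (N + 1) × PosRoot b) :
    ⁅currentBasis b N (Sum.inl p), currentBasis b N (Sum.inl q)⁆ ∈
      Submodule.span K (Set.range fun p => currentBasis b N (Sum.inl p)) := by
  simp only [currentBasis_inl, tmul_lie_tmul]
  exact tmul_mem_span N (fun a : PosRoot b => negVector a) _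
    (Submodule.span_mono (Set.image_subset_range _ _) (lie_negVector_negVector_mem p.2 q.2))

lemma finiteDimensional_currentAlgebra (b : (rootSystem H).Base) (N : ℕ) :
    FiniteDimensional K (CurrentAlgebra K L N) :=
  .of_basis (currentBasis b N)

/-- The basis of the truncated current Lie algebra, split along the subalgebra `ĥ ⊕ ĝ₊`. -/
def currentSplitBasis (b : (rootSystem H).Base) (N : ℕ) :
    SplitBasis (borelHat b N) (Fin (N + 1) × PosRoot b)
      (Fin (N + 1) × (Fin (Module.finrank K H) ⊕ PosRoot b)) where
  z := currentBasis b N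
  inr_mem := currentBasis_inr_mem b N
  mem_span_inr := mem_span_currentBasis_inr b N
  lie_inl := lie_currentBasis_inl_mem b N

lemma currentSplitBasis_inl (b : (rootSystem H).Base) (N : ℕ) (p : Fin (N + 1) × PosRoot b) :
    (currentSplitBasis b N).z (Sum.inl p) = tPow K N p.1 ⊗ₜ[K] negVector p.2 :=
  currentBasis_inl b N p

/-! ### The Verma module as a highest weight representation -/

attribute [local instance 100] LieRing.ofAssociativeRing

variable (b : (rootSystem H).Base) {N : ℕ} (Λ : Module.Dual K (cartanHat H N))

/-- The highest weight vector of the Verma module. -/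
def vermaVector : Verma b N Λ := inducedVector (borelCharacter b N Λ)

lemma ι_smul_vermaVector {x : CurrentAlgebra K L N} (hx : x ∈ borelHat b N) :
    UniversalEnvelopingAlgebra.ι K x • vermaVector b Λ =
      Λ (cartanHatProj H N x) • vermaVector b Λ :=
  ι_smul_inducedVector (borelCharacter b N Λ) ⟨x, hx⟩

variable {b Λ} in
lemma ι_smul_mem_of_stable {S : Submodule K (Verma b N Λ)}
    (hS : ∀ (i : ℕ) (x : L), ∀ m ∈ S, UniversalEnvelopingAlgebra.ι K (tPow K N i ⊗ₜ[K] x) • m ∈ S)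
    (x : CurrentAlgebra K L N) (m : Verma b N Λ) (hm : m ∈ S) :
    UniversalEnvelopingAlgebra.ι K x • m ∈ S := by
  have hx : x ∈ Submodule.span K
      {z : CurrentAlgebra K L N | ∃ (i : ℕ) (x : L), z = tPow K N i ⊗ₜ[K] x} := by
    rw [span_tPow_tmul]; trivial
  induction hx using Submodule.span_induction with
  | mem x hx => obtain ⟨i, x, rfl⟩ := hx; exact hS i x m hm
  | zero => rw [map_zero, zero_smul]; exact zero_mem _
  | add x y _ _ hx hy => rw [map_add, add_smul]; exact add_mem hx hy
  | smul c x _ hx => rw [map_smul, smul_assoc]; exact S.smul_mem c hx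

/-- The action of `t ^ i ⊗ x` on the Verma module. -/
def vermaAction (i : ℕ) : L →ₗ[K] Module.End K (Verma b N Λ) :=
  (Algebra.lsmul K K (Verma b N Λ)).toLinearMap ∘ₗ
    (UniversalEnvelopingAlgebra.ι K (L := CurrentAlgebra K L N)).toLinearMap ∘ₗ
      TensorProduct.mk K (TruncPoly K N) L (tPow K N i)

lemma vermaAction_apply (i : ℕ) (x : L) (m : Verma b N Λ) : vermaAction b Λ i x m =
    UniversalEnvelopingAlgebra.ι K (tPow K N i ⊗ₜ[K] x : CurrentAlgebra K L N) • m :=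
  rfl

lemma vermaAction_comm (i j : ℕ) (x y : L) (m : Verma b N Λ) :
    vermaAction b Λ i x (vermaAction b Λ j y m) =
      vermaAction b Λ j y (vermaAction b Λ i x m) + vermaAction b Λ (i + j) ⁅x, y⁆ m := by
  simp only [vermaAction_apply]
  rw [← tmul_lie_tmul, LieHom.map_lie, LieRing.of_associative_ring_bracket, sub_smul, mul_smul,
    mul_smul, add_sub_cancel]

lemma vermaAction_posVector (i : ℕ) (a : PosRoot b) :
    vermaAction b Λ i (posVector a) (vermaVector b Λ) = 0 := by
  have hmem : tPow K N i ⊗ₜ[K] posVector a ∈ positiveHat b N :=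
    tmul_mem_currentSubspace (V := positivePart b) N _
      (Submodule.mem_iSup_of_mem a (posVector_mem a))
  have hle : positiveHat b N ≤ cartanHat H N ⊔ positiveHat b N := le_sup_right
  rw [vermaAction_apply, ι_smul_vermaVector b Λ (hle hmem),
    cartanHatProj_apply_of_mem_positiveHat b N hmem, map_zero, zero_smul]

lemma vermaAction_cartan (i : ℕ) (h : L) (hh : h ∈ H.toSubmodule) :
    vermaAction b Λ i h (vermaVector b Λ) =
      Λ (cartanHatProj H N (tPow K N i ⊗ₜ h)) • vermaVector b Λ := by
  have hmem : tPow K N i ⊗ₜ[K] h ∈ cartanHat H N :=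
    tmul_mem_currentSubspace (V := H.toSubmodule) N _ hh
  have hle : cartanHat H N ≤ cartanHat H N ⊔ positiveHat b N := le_sup_left
  rw [vermaAction_apply, ι_smul_vermaVector b Λ (hle hmem)]

lemma vermaModule_cyclic (S : Submodule K (Verma b N Λ)) (hv : vermaVector b Λ ∈ S)
    (hS : ∀ i x, ∀ m ∈ S, vermaAction b Λ i x m ∈ S) : S = ⊤ := by
  refine eq_top_iff.mpr fun m _ => ?_
  obtain ⟨u, rfl⟩ := inducedModule_cyclic (borelCharacter b N Λ) m
  exact smul_mem_of_ι_smul_mem S (ι_smul_mem_of_stable hS) u hv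

/-- The Verma module as a highest weight representation. -/
def vermaRep : HighestWeightRep (rootVectors b) N (Verma b N Λ) where
  ρ := vermaAction b Λ
  v := vermaVector b Λ
  wt i h := Λ (cartanHatProj H N (tPow K N i ⊗ₜ h))
  comm := vermaAction_comm b Λ
  trunc i hi := by
    rw [vermaAction, tPow_eq_zero K N hi, map_zero, LinearMap.comp_zero, LinearMap.comp_zero]
  ρ_e_v := vermaAction_posVector b Λ
  ρ_cartan_v := vermaAction_cartan b Λ
  cyclic := vermaModule_cyclic b Λ

/-- The last component of the highest weight at `⁅e a, f a⁆`. -/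
lemma vermaRep_wt (a : PosRoot b) :
    (vermaRep b Λ).wt N ⁅(rootVectors b).e a, (rootVectors b).f a⁆ =
      dualKillingForm H (component Λ N) ((rootSystem H).root a.1) := by
  have h1 := lie_posVector_negVector a
  rw [dualKillingForm_apply, component_apply]
  change Λ (cartanHatProj H N (tPow K N N ⊗ₜ ⁅posVector a, negVector a⁆)) = _
  rw [h1]
  exact congrArg Λ (cartanHatProj_apply_of_mem H N ⟨_, tmul_mem_currentSubspace N _
    (SetLike.coe_mem ((cartanEquivDual H).symm a.1.1.toLinear))⟩)

/-- A root is orthogonal to a weight if and only if its negative is. -/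
lemma exists_posRoot_of_exists_root (l : Module.Dual K H)
    (h : ∃ α : H.root, dualKillingForm H l ((rootSystem H).root α) = 0) :
    ∃ a : PosRoot b, dualKillingForm H l ((rootSystem H).root a.1) = 0 := by
  obtain ⟨α, hα⟩ := h
  by_cases hpos : b.IsPos α
  · exact ⟨⟨α, hpos⟩, hα⟩
  · obtain ⟨β, hβ⟩ := exists_neg_root α
    have hβ' : (rootSystem H).root β = -(rootSystem H).root α := hβ
    refine ⟨⟨β, ?_⟩, ?_⟩
    · have h1 := heightFunctional_apply (b := b) β
      rw [hβ, map_neg, heightFunctional_apply] at h1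
      have h2 : -b.height α = b.height β := by exact_mod_cast h1
      rw [RootPairing.Base.isPos_iff] at hpos ⊢
      have := b.height_ne_zero α
      omega
    · rw [hβ', map_neg, hα, neg_zero]

lemma yWord_smul_vermaVector (l : List (Fin (N + 1) × PosRoot b)) :
    (currentSplitBasis b N).yWord l • vermaVector b Λ =
      (vermaRep b Λ).word (l.map Prod.swap) := by
  induction l with
  | nil => simp [SplitBasis.yWord, vermaRep]
  | cons p l ih =>
    rw [List.map_cons, HighestWeightRep.word_cons, ← ih, SplitBasis.yWord, List.map_cons,
      List.prod_cons, mul_smul, SplitBasis.y, currentSplitBasis_inl]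
    rfl

/-- The map from the Verma module to the quotient of the enveloping algebra by the left ideal that
annihilates the highest weight vector. -/
def vermaToQuotient : Verma b N Λ →ₗ[UniversalEnvelopingAlgebra K (CurrentAlgebra K L N)]
    UniversalEnvelopingAlgebra K (CurrentAlgebra K L N) ⧸ characterIdeal (borelCharacter b N Λ) :=
  inducedToQuotient (borelCharacter b N Λ)

lemma vermaToQuotient_smul_vector (u : UniversalEnvelopingAlgebra K (CurrentAlgebra K L N)) :
    vermaToQuotient b Λ (u • vermaVector b Λ) = (characterIdeal (borelCharacter b N Λ)).mkQ u := by
  have h : vermaToQuotient b Λ (vermaVector b Λ) = (characterIdeal (borelCharacter b N Λ)).mkQ 1 :=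
    inducedToQuotient_vector (borelCharacter b N Λ)
  rw [map_smul, h, ← map_smul, smul_eq_mul, mul_one]

/-- The words in the `t ^ N ⊗ f a`, one for each multiset, are linearly independent, being part of
the family of all words in the lowering operators. -/
lemma linearIndependent_topWord (hN : 0 < N) : LinearIndependent K
    fun m : Multiset (PosRoot b) => (vermaRep b Λ).topWord m.toList := by
  have := finiteDimensional_currentAlgebra b N
  have h := (currentSplitBasis b N).linearIndependent_mk_yWord (borelCharacter b N Λ)
    (currentAlgebra_centre N (eq_zero_of_forall_lie_eq_zero K))
  let g : PosRoot b → Fin (N + 1) × PosRoot b := fun a => (Fin.last N, a)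
  have hg : Function.Injective g := fun a c h => (Prod.mk.inj h).2
  have h1 := h.comp _ (Multiset.map_injective hg)
  refine LinearIndependent.of_comp ((vermaToQuotient b Λ).restrictScalars K) ?_
  have h4 : ⇑((vermaToQuotient b Λ).restrictScalars K) ∘
      (fun m : Multiset (PosRoot b) => (vermaRep b Λ).topWord m.toList) =
      (fun m : Multiset (Fin (N + 1) × PosRoot b) => (characterIdeal (borelCharacter b N Λ)).mkQ
        ((currentSplitBasis b N).yWord m.toList)) ∘ Multiset.map g := by
    funext m
    have h2 : (vermaRep b Λ).topWord m.toList =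
        (currentSplitBasis b N).yWord (m.map g).toList • vermaVector b Λ := by
      have h3 : ((m.map g).toList.map Prod.swap) =
          ((m.map g).toList.map Prod.snd).map fun a => (a, Fin.last N) := by
        rw [List.map_map]
        refine List.map_congr_left fun p hp => ?_
        rw [Multiset.mem_toList, Multiset.mem_map] at hp
        obtain ⟨a, -, rfl⟩ := hp
        rfl
      rw [yWord_smul_vermaVector, h3]
      refine (vermaRep b Λ).topWord_perm hN ?_
      rw [← Multiset.coe_eq_coe, ← Multiset.map_coe, Multiset.coe_toList, Multiset.coe_toList,
        Multiset.map_map]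
      simp [g]
    exact (congrArg (vermaToQuotient b Λ) h2).trans (vermaToQuotient_smul_vector b Λ _)
  rw [h4]
  exact h1

/-- The functional that takes the coefficient of the highest weight vector. -/
lemma exists_vermaFunctional : ∃ φ : Verma b N Λ →ₗ[K] K,
    φ (vermaRep b Λ).v = 1 ∧ ∀ p m, φ ((vermaRep b Λ).Y p m) = 0 := by
  have := finiteDimensional_currentAlgebra b N
  obtain ⟨φ, h1, h2⟩ := (currentSplitBasis b N).exists_functional (borelCharacter b N Λ)
    (currentAlgebra_centre N (eq_zero_of_forall_lie_eq_zero K))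
  refine ⟨φ ∘ₗ (vermaToQuotient b Λ).restrictScalars K, ?_, fun p m => ?_⟩
  · refine (congrArg φ ?_).trans h1
    rw [← vermaToQuotient_smul_vector, one_smul]
    rfl
  · have h3 : (vermaRep b Λ).Y p m = (currentSplitBasis b N).y p.swap • m := by
      rw [SplitBasis.y, currentSplitBasis_inl]; rfl
    rw [h3]
    exact (congrArg φ (map_smul (vermaToQuotient b Λ) _ m)).trans (h2 _ _)

theorem isReducible_verma_iff (hN : 0 < N) :
    IsReducible (UniversalEnvelopingAlgebra K (CurrentAlgebra K L N)) (Verma b N Λ) ↔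
      ∃ α : H.root, dualKillingForm H (component Λ N) ((rootSystem H).root α) = 0 := by
  constructor
  · rintro ⟨S, hS0, hS1⟩
    by_contra! hcon
    refine hS1 (eq_top_iff.mpr fun m _ => ?_)
    have hv : vermaVector b Λ ∈ S.restrictScalars K :=
      (vermaRep b Λ).v_mem_of_regular hN
        (fun a => by rw [vermaRep_wt]; exact hcon a.1) (S.restrictScalars K)
        (fun i x m hm => S.smul_mem _ hm) (by simpa using hS0)
    obtain ⟨u, rfl⟩ := inducedModule_cyclic (borelCharacter b N Λ) m
    exact S.smul_mem u hv
  · intro h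
    obtain ⟨a, ha⟩ := exists_posRoot_of_exists_root b _ h
    obtain ⟨φ, hv, hφ⟩ := exists_vermaFunctional b Λ
    obtain ⟨S, hS, hS0, hS1⟩ := (vermaRep b Λ).exists_stable_of_singular hN hφ hv
      (linearIndependent_topWord b Λ hN) ((vermaRep_wt b Λ a).trans ha)
    let S' : Submodule (UniversalEnvelopingAlgebra K (CurrentAlgebra K L N)) (Verma b N Λ) :=
      { S with smul_mem' := fun u _ hm => smul_mem_of_ι_smul_mem S (ι_smul_mem_of_stable hS) u hm }
    have hmem (m : Verma b N Λ) : m ∈ S' ↔ m ∈ S := Iff.rfl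
    refine ⟨S', fun h => hS0 ?_, fun h => hS1 ?_⟩
    · refine (Submodule.eq_bot_iff _).mpr fun m hm => ?_
      have := (hmem m).mpr hm
      rw [h] at this
      exact (Submodule.mem_bot _).mp this
    · refine eq_top_iff.mpr fun m _ => (hmem m).mp ?_
      rw [h]; trivial

end Verma

end TruncatedCurrent

end

open TruncatedCurrent in
theorem mainTheorem6 {K L : Type*} [Field K] [CharZero K] [LieRing L] [LieAlgebra K L]
    [FiniteDimensional K L] [LieAlgebra.IsSemisimple K L]
    (H : LieSubalgebra K L) [H.IsCartanSubalgebra] [LieModule.IsTriangularizable K H L]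
    (b : (LieAlgebra.IsKilling.rootSystem H).Base) (N : ℕ) (hN : 0 < N)
    (Λ : Module.Dual K (cartanHat H N)) :
    IsReducible (UniversalEnvelopingAlgebra K (CurrentAlgebra K L N)) (Verma b N Λ) ↔
      ∃ α : H.root, dualKillingForm H (component Λ N)
        ((LieAlgebra.IsKilling.rootSystem H).root α) = 0 :=
  isReducible_verma_iff b Λ hN
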